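/- Let $\Omega\subset\mathbb R$ be open, $u:\Omega\to\mathbb R$ smooth, $x\in\Omega$, and let $N$ be odd. For $h=\Delta x>0$ take $N$ consecutive cells of size $h$ whose union contains $x$, with leftmost interface $x-\theta h$, $0\le\theta\le N$, and let $\bar u_i$ be the cell averages of $u$. Let $\phi:\mathbb K\to\mathbb K$ ($\mathbb K=\mathbb R$ or $\mathbb C$) be even and smooth at $0$, and use the basis function $y\mapsto\phi(\lambda y)$ with shape parameter $\lambda\in\mathbb K$. Two approximants of $u(x)$ are built from the cell averages: * (direct) $Au(x)=\sum_{k=1}^{N}\alpha_k\,\phi(\lambda(x-x_k))$, $x_k$ the cell centres, where $Au$ has the cell averages $\bar u_i$; * (primitive) $AU'(x)$, where $AU=\sum_{k=0}^{N}\alpha_k\,\phi(\lambda(\cdot-x_k))$, $x_k$ the $N+1$ interfaces, interpolates at the interfaces the primitive function $U$ of $u$ vanishing at one (any) of them; the values $U(x_k)$ are signed sums of the $h\bar u_i$. Put $n=N$ (direct) or $n=N+1$ (primitive), assume that $\det(\phi^{(i+j)}(0))_{0\le i,j<n}\neq0$, let $c=(c_0,\dots,c_{n-1})$ solve $\sum_j\phi^{(i+j)}(0)c_j=\phi^{(i+n)}(0)$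 for $0\le i<n$, and put $$P(\lambda)=u^{(N)}(x)-\sum_{j=0}^{N-1}c_{j+n-N}\,\lambda^{N-j}u^{(j)}(x),\qquad \kappa(\theta)=-\frac{1}{(N+1)!}\frac{d}{d\theta}\prod_{k=0}^{N}(\theta-k).$$ 1. For every $M$ there are $C,\delta>0$ (depending on $x$, but not on $h,\theta,\lambda$) such that for $0<h<\delta$ and $0<|\lambda|\le M$ the coefficients $\alpha_k$ exist and are unique, and the approximant differs from $u(x)+\kappa(\theta)h^NP(\lambda)$ by at most $Ch^{N+1}$. If $P(\lambda_0)=0$, then every choice $\lambda(h)\ne0$ with $\lambda(h)^2=\lambda_0^2+O(h)$ makes the approximant of order $N+1$: it equals $u(x)+O(h^{N+1})$, uniformly in $\theta$. 2. If $\mathbb K=\mathbb C$, $N\ge3$, $u'(x)\ne0$ and $c_{1+n-N}\neq0$, then there are bounded shape parameters $\lambda(h)$ for which the approximant is of order $N+1$. 3. For the Gaussian $\phi(z)=e^{-z^2}$ all these determinants are nonzero. For every odd $N\ge3$ and $u'(x)\neq0$, each of the two approximants can be made of order $N+1$ by bounded shape parameters $\lambda(h)\in\mathbb C$; if $N\equiv3\pmod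 4$, $\lambda(h)^2$ can be taken real, that is, $\lambda(h)\in\mathbb R\cup i\mathbb R$. 4. Let $N=3$, let the basis function be $e^{-\lambda^2y^2}$ with $\lambda^2\in\mathbb R$, and let $x=x_{j+1/2}$ be the right interface of the middle cell, in the primitive reconstruction with $U(x_{j-1/2})=0$. Then, uniformly for $0<|\lambda^2|\le M$, with unique coefficients for small $h$, $$AU'(x)=u(x)+h^3\Big(\lambda^2u'(x)+\tfrac1{12}u'''(x)\Big)+O(h^4).$$ If $u'(x)\ne0$, bounded nonzero $\lambda(h)^2$ give $AU'(x)=u(x)+O(h^4)$ if and only if $\lambda(h)^2=-\dfrac{u'''(x)}{12u'(x)}+O(h)$. -/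

import Mathlib

open scoped ContDiff Topology
open Filter Asymptotics

namespace RBFReconstruction

noncomputable section

/-! The grid. A stencil of `N` consecutive cells of size `h` with leftmost interface `a` consists of
the cells `[a + i h, a + (i + 1) h]`, `i = 0, …, N - 1`. -/

/-- Interface number `k` of the stencil. -/
def face (a h : ℝ) (k : ℕ) : ℝ := a + k * h

/-- Centre of cell number `k` of the stencil. -/
def center (a h : ℝ) (k : ℕ) : ℝ := a + (k + 1 / 2) * h

/-- The average of `f` over cell number `i`. -/
def cellAverage {𝕜 : Type} [RCLike 𝕜] (f : ℝ → 𝕜) (a h : ℝ) (i : ℕ) : 𝕜 :=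
  (h : 𝕜)⁻¹ * ∫ y in (face a h i)..(face a h (i + 1)), f y

/-- The basis function `y ↦ φ (l y)` obtained from `φ` with the shape parameter `l`. -/
def shaped {𝕜 : Type} [RCLike 𝕜] (φ : 𝕜 → 𝕜) (l : 𝕜) (y : ℝ) : 𝕜 := φ (l * (y : 𝕜))

/-- The linear combination `∑ α_k B(y - X_k)` of translates of `B`. -/
def rbfSum {𝕜 : Type} [RCLike 𝕜] {n : ℕ} (B : ℝ → 𝕜) (X : ℕ → ℝ) (α : Fin n → 𝕜) (y : ℝ) : 𝕜 :=
  ∑ k : Fin n, α k * B (y - X k)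

/-! ### Direct reconstruction: `N` translates centred at the cell centres, matching the averages -/

/-- `Au = ∑ α_k B(· - x_k)`, with the cell centres `x_k` as reference points, has the prescribed
cell averages `v`. -/
def FitsAverages {𝕜 : Type} [RCLike 𝕜] {N : ℕ} (B : ℝ → 𝕜) (a h : ℝ) (v : Fin N → ℝ)
    (α : Fin N → 𝕜) : Prop :=
  ∀ i : Fin N, cellAverage (rbfSum B (center a h) α) a h i = (v i : 𝕜)

/-- The cell averages of `u` over the stencil determine the coefficients of the direct reconstruction
uniquely, and `Au(x)` differs from `w` by at most `ε`. -/
def DirectWithin {𝕜 : Type} [RCLike 𝕜] (N : ℕ) (B : ℝ → 𝕜) (u : ℝ → ℝ) (a h x : ℝ) (w : 𝕜)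
    (ε : ℝ) : Prop :=
  ∃ α : Fin N → 𝕜,
    FitsAverages B a h (fun i => cellAverage u a h i) α ∧
    (∀ β : Fin N → 𝕜, FitsAverages B a h (fun i => cellAverage u a h i) β → β = α) ∧
    ‖rbfSum B (center a h) α x - w‖ ≤ ε

/-! ### Reconstruction through a primitive function -/

/-- The values at the interfaces, written through the cell averages `v`, of the primitive function
that vanishes at interface number `b`. -/
def primitiveData {N : ℕ} (h : ℝ) (v : Fin N → ℝ) (b k : Fin (N + 1)) : ℝ :=
  h * ((∑ i : Fin N, if (i : ℕ) < k then v i else 0) - ∑ i : Fin N, if (i : ℕ) < b then v i else 0)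

/-- `AU = ∑ α_k B(· - x_k)`, with the interfaces `x_k` as reference points, interpolates the primitive
function at the interfaces. -/
def FitsPrimitive {𝕜 : Type} [RCLike 𝕜] {N : ℕ} (B : ℝ → 𝕜) (a h : ℝ) (b : Fin (N + 1))
    (v : Fin N → ℝ) (α : Fin (N + 1) → 𝕜) : Prop :=
  ∀ k : Fin (N + 1), rbfSum B (face a h) α (face a h k) = (primitiveData h v b k : 𝕜)

/-- The cell averages of `u` over the stencil determine the coefficients of the interpolant `AU` of
the primitive function uniquely, and `AU'(x) = ∑ α_k B'(x - x_k)` differs from `w` by at most `ε`. -/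
def PrimitiveWithin {𝕜 : Type} [RCLike 𝕜] (N : ℕ) (B : ℝ → 𝕜) (u : ℝ → ℝ) (a h : ℝ)
    (b : Fin (N + 1)) (x : ℝ) (w : 𝕜) (ε : ℝ) : Prop :=
  ∃ α : Fin (N + 1) → 𝕜,
    FitsPrimitive B a h b (fun i => cellAverage u a h i) α ∧
    (∀ β : Fin (N + 1) → 𝕜, FitsPrimitive B a h b (fun i => cellAverage u a h i) β → β = α) ∧
    ‖rbfSum (deriv B) (face a h) α x - w‖ ≤ ε

/-! ### Order of accuracy

The evaluation point `x` is fixed and `h → 0`; the stencil of cells may have any position relative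
to `x`, as long as it contains `x`: its leftmost interface is `x - θ h` with `0 ≤ θ ≤ N`. -/

/-- With the shape parameters `l h`, the direct reconstruction satisfies
`Au(x) = u(x) + O(h ^ p)`. -/
def DirectOrder {𝕜 : Type} [RCLike 𝕜] (N : ℕ) (φ : 𝕜 → 𝕜) (l : ℝ → 𝕜) (u : ℝ → ℝ) (x : ℝ)
    (p : ℕ) : Prop :=
  ∃ C > (0 : ℝ), ∃ δ > (0 : ℝ), ∀ h : ℝ, 0 < h → h < δ → ∀ θ ∈ Set.Icc (0 : ℝ) N,
    DirectWithin N (shaped φ (l h)) u (x - θ * h) h x (u x : 𝕜) (C * h ^ p)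

/-- With the shape parameters `l h`, the reconstruction through a primitive function satisfies
`AU'(x) = u(x) + O(h ^ p)`. -/
def PrimitiveOrder {𝕜 : Type} [RCLike 𝕜] (N : ℕ) (φ : 𝕜 → 𝕜) (l : ℝ → 𝕜) (u : ℝ → ℝ) (x : ℝ)
    (p : ℕ) : Prop :=
  ∃ C > (0 : ℝ), ∃ δ > (0 : ℝ), ∀ h : ℝ, 0 < h → h < δ → ∀ θ ∈ Set.Icc (0 : ℝ) N,
    ∀ b : Fin (N + 1),
      PrimitiveWithin N (shaped φ (l h)) u (x - θ * h) h b x (u x : 𝕜) (C * h ^ p)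

/-! ### The leading error term -/

/-- The matrix `φ^(i+j)(0)`, `0 ≤ i, j < n`. -/
def derivMatrix {𝕜 : Type} [RCLike 𝕜] (φ : 𝕜 → 𝕜) (n : ℕ) : Matrix (Fin n) (Fin n) 𝕜 :=
  Matrix.of fun i j => iteratedDeriv ((i : ℕ) + j) φ 0

/-- The coefficients `c_0, …, c_{n-1}` for which the functional
`f ↦ f^(n)(0) - ∑_{j<n} c_j f^(j)(0)` annihilates `φ, φ', …, φ^(n-1)`
(if `derivMatrix φ n` is invertible). -/
def errorCoeff {𝕜 : Type} [RCLike 𝕜] (φ : 𝕜 → 𝕜) (n : ℕ) : Fin n → 𝕜 :=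
  (derivMatrix φ n)⁻¹.mulVec fun i => iteratedDeriv ((i : ℕ) + n) φ 0

/-- The factor of the leading error term of the direct reconstruction that depends on the shape
parameter `l`. -/
def directSymbol {𝕜 : Type} [RCLike 𝕜] (N : ℕ) (φ : 𝕜 → 𝕜) (u : ℝ → ℝ) (x : ℝ) (l : 𝕜) : 𝕜 :=
  ((iteratedDeriv N u x : ℝ) : 𝕜) -
    ∑ j : Fin N, errorCoeff φ N j * l ^ (N - (j : ℕ)) * ((iteratedDeriv j u x : ℝ) : 𝕜)

/-- The factor of the leading error term of the reconstruction through a primitive function that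
depends on the shape parameter `l`. -/
def primitiveSymbol {𝕜 : Type} [RCLike 𝕜] (N : ℕ) (φ : 𝕜 → 𝕜) (u : ℝ → ℝ) (x : ℝ) (l : 𝕜) : 𝕜 :=
  ((iteratedDeriv N u x : ℝ) : 𝕜) -
    ∑ j : Fin N, errorCoeff φ (N + 1) j.succ * l ^ (N - (j : ℕ)) * ((iteratedDeriv j u x : ℝ) : 𝕜)

/-- The factor of the leading error term that depends only on the position of `x` in the stencil. -/
def positionFactor (N : ℕ) (θ : ℝ) : ℝ :=
  -(deriv (fun t : ℝ => ∏ k ∈ Finset.range (N + 1), (t - k)) θ) / (N + 1).factorial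

/-! ### The Gaussian -/

/-- The Gaussian `e^{-z²}`; a shape parameter `l ∈ ℝ` or `l ∈ iℝ` means that `l²` is real. -/
def gaussian (z : ℂ) : ℂ := Complex.exp (-z ^ 2)

/-- The Gaussian basis function `e^{-s y²}` with `s = λ²` real, that is, `λ ∈ ℝ` or `λ ∈ iℝ`. -/
def realGaussian (s y : ℝ) : ℝ := Real.exp (-s * y ^ 2)

end

end RBFReconstruction

open RBFReconstruction

/-! In the coordinate s = (y - x)/h and with ε = λh, the statement concerns collocation with
translates φ(ε(s - c_k)) in the flat limit ε → 0, where the linear system degenerates. Taylor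
expansion of φ at 0 gives the system matrix A as Σ φ^(p+q)(0) ε^(p+q) μ_{i,p} γ_{k,q} up to
O(ε^(2n)), where μ_{i,p} is the value of the i-th data functional on s^p/p! and γ_{k,q} the value of
s^q/q! at -c_k. With the inverses E, C of the two moment matrices, E A Cᵀ = D K D, where D =
diag(ε^p) and K tends to the Hankel matrix φ^(i+j)(0). All degeneration sits in D, so a nonsingular
Hankel matrix makes the system uniquely solvable. The moment matrices depend continuously on θ in a
compact interval, which makes the bounds uniform.

By duality the approximant is w · v with w A = b and v the data. The weights κ of the polynomial
reconstruction exact in degrees below n leave a residual b - κA that starts at order ε^n, with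
coefficients `momentError` times φ^(n+q)(0). Solving against K, the correction tends to
`momentError` times c. Hence the polynomial error term with f^(n) is replaced by one with f^(n) - Σ
c_j λ^(n-j) f^(j): this is `exists_weights_isBigO`. The factor `momentError` is read off from a
polynomial annihilated by all data functionals, built from the nodal polynomial of the interfaces.
The direct method is the case of f = u and cell averages; the primitive one is the case of f = U,
point values and the target h d/dx, where the term with U(x) = O(h) drops into the remainder.

If φ is even, c_j = 0 for j + n odd, so for odd N the factor P is a polynomial in λ². If c_{1+n-N}
and u'(x) are nonzero and N ≥ 3, its degree is (N-1)/2, with leading coefficient -c_{1+n-N} u'(x).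
It then has a complex root, and for real coefficients a real root if (N-1)/2 is odd; near a root the
error gains one order.

For the Gaussian, the Hankel matrix belongs to a moment functional with explicit orthogonal
polynomials `gaussPoly` (Hermite polynomials at imaginary argument). Orthogonality triangularises
the matrix, and c consists of the negated coefficients of `gaussPoly n`, which are positive in the
degrees of the right parity. -/

/-! ### Taylor remainders over ℝ and ℂ -/

theorem hasDerivAt_taylorSum {𝕜 : Type*} [RCLike 𝕜] (d : ℕ → 𝕜) (n : ℕ) (z : 𝕜) :
    HasDerivAt (fun z => ∑ m ∈ Finset.range (n + 1), d m * z ^ m / (m.factorial : 𝕜))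
      (∑ m ∈ Finset.range n, d (m + 1) * z ^ m / (m.factorial : 𝕜)) z := by
  have h : ∀ m ∈ Finset.range (n + 1), HasDerivAt (fun z : 𝕜 => d m * z ^ m / (m.factorial : 𝕜))
      (d m * (m * z ^ (m - 1)) / (m.factorial : 𝕜)) z := fun m _ =>
    ((hasDerivAt_pow m z).const_mul _).div_const _
  refine (HasDerivAt.fun_sum h).congr_deriv (Eq.symm ?_)
  rw [Finset.sum_range_succ']
  simp only [CharP.cast_eq_zero, zero_mul, mul_zero, zero_div, add_zero, Nat.add_sub_cancel]
  refine Finset.sum_congr rfl fun m _ => ?_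
  have h1 : (m.factorial : 𝕜) ≠ 0 := Nat.cast_ne_zero.mpr m.factorial_ne_zero
  have h2 : ((m + 1 : ℕ) : 𝕜) ≠ 0 := Nat.cast_ne_zero.mpr m.succ_ne_zero
  rw [Nat.factorial_succ, Nat.cast_mul]
  field_simp

theorem contDiffAt_deriv_infty {𝕜 : Type*} [RCLike 𝕜] {f : 𝕜 → 𝕜} {a : 𝕜}
    (hf : ContDiffAt 𝕜 ∞ f a) : ContDiffAt 𝕜 ∞ (deriv f) a :=
  hf.derivWithin (m := ∞) (by simp) |>.congr_of_eventuallyEq (by simp)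

/-- Induction on the order: the derivative of the remainder is the remainder of f' of one order
less, and the mean value inequality on the closed ball of radius ‖z‖ integrates its bound. The
argument is the same over ℝ and ℂ. -/
theorem isBigO_sub_taylorSum {𝕜 : Type*} [RCLike 𝕜] (n : ℕ) {f : 𝕜 → 𝕜} {a : 𝕜}
    (hf : ContDiffAt 𝕜 ∞ f a) :
    (fun z => f (a + z) - ∑ m ∈ Finset.range n, iteratedDeriv m f a * z ^ m / (m.factorial : 𝕜))
      =O[𝓝 0] fun z => z ^ n := by
  induction n generalizing f with
  | zero =>
    have hc : ContinuousAt (fun z => f (a + z)) 0 :=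
      ContinuousAt.comp (by simpa using hf.continuousAt) (by fun_prop)
    simpa using hc.isBigO_one 𝕜
  | succ n ih =>
    obtain ⟨c, hc⟩ := (ih (contDiffAt_deriv_infty hf)).bound
    have hd : ∀ᶠ z in 𝓝 (0 : 𝕜), DifferentiableAt 𝕜 f (a + z) := by
      have h1 : ∀ᶠ y in 𝓝 a, DifferentiableAt 𝕜 f y :=
        (hf.of_le (by simp : (1 : WithTop ℕ∞) ≤ ∞)).eventually (by simp) |>.mono fun y hy =>
          hy.differentiableAt (by simp)
      have h2 : Tendsto (fun z : 𝕜 => a + z) (𝓝 0) (𝓝 a) :=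
        Continuous.tendsto' (by fun_prop) 0 a (by simp)
      exact h2.eventually h1
    obtain ⟨r, hr, hball⟩ := Metric.eventually_nhds_iff_ball.mp (hc.and hd)
    refine IsBigO.of_bound c (Metric.eventually_nhds_iff_ball.mpr ⟨r, hr, fun z hz => ?_⟩)
    have hsub : ∀ y ∈ Metric.closedBall (0 : 𝕜) ‖z‖, y ∈ Metric.ball (0 : 𝕜) r := fun y hy => by
      simp only [Metric.mem_closedBall, Metric.mem_ball, dist_zero_right] at *
      exact hy.trans_lt hz
    have key := (convex_closedBall (0 : 𝕜) ‖z‖).norm_image_sub_le_of_norm_hasDerivWithin_le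
      (𝕜 := 𝕜) (C := c * ‖z‖ ^ n) (x := 0) (y := z)
      (f := fun z => f (a + z) -
        ∑ m ∈ Finset.range (n + 1), iteratedDeriv m f a * z ^ m / (m.factorial : 𝕜))
      (f' := fun z => deriv f (a + z) -
        ∑ m ∈ Finset.range n, iteratedDeriv (m + 1) f a * z ^ m / (m.factorial : 𝕜))
      (fun y hy => ?_) (fun y hy => ?_) (by simp) (by simp)
    · have h0 : ∑ m ∈ Finset.range (n + 1), iteratedDeriv m f a * (0 : 𝕜) ^ m / (m.factorial : 𝕜)
          = f a := by
        rw [Finset.sum_range_succ']; simp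
      simp only [h0, add_zero, sub_self, sub_zero] at key
      rw [norm_pow, pow_succ, ← mul_assoc]
      exact key
    · exact (((hball y (hsub y hy)).2.hasDerivAt.comp_const_add a y).sub
        (hasDerivAt_taylorSum _ n y)).hasDerivWithinAt
    · have hb := (hball y (hsub y hy)).1
      simp only [← iteratedDeriv_succ'] at hb
      refine hb.trans ?_
      -- The constant supplied by `bound` need not be nonnegative; its sign is forced by the bound
      -- itself, except at z = 0.
      have hcn : 0 ≤ c * ‖z‖ ^ n ∨ z = 0 := by
        by_cases hz0 : z = 0
        · exact Or.inr hz0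
        · left
          have := (norm_nonneg _).trans (hball z hz).1
          rwa [norm_pow] at this
      simp only [Metric.mem_closedBall, dist_zero_right] at hy
      rcases hcn with h | h
      · by_cases hz0 : z = 0
        · subst hz0
          have : y = 0 := by simpa using hy
          subst this; simp
        · have hc0 : 0 ≤ c := by
            have : 0 < ‖z‖ ^ n := by positivity
            exact nonneg_of_mul_nonneg_left h this
          rw [norm_pow]; gcongr
      · subst h
        have : y = 0 := by simpa using hy
        subst this; simp

theorem intervalIntegral_ofReal {𝕜 : Type*} [RCLike 𝕜] (f : ℝ → ℝ) (a b : ℝ) :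
    ∫ t in a..b, (f t : 𝕜) = ((∫ t in a..b, f t : ℝ) : 𝕜) := by
  simp only [intervalIntegral, integral_ofReal, RCLike.ofReal_sub]

theorem norm_integral_sub_taylorSum_le {𝕜 : Type*} [RCLike 𝕜] {g : ℝ → 𝕜} {a b B : ℝ} {K : ℕ}
    {d : ℕ → 𝕜} (hg : ContinuousOn g (Set.uIcc a b))
    (h : ∀ t ∈ Set.uIcc a b,
      ‖g t - ∑ p ∈ Finset.range K, d p * (t : 𝕜) ^ p / (p.factorial : 𝕜)‖ ≤ B) :
    ‖(∫ t in a..b, g t) -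
      ∑ p ∈ Finset.range K, d p * (((b ^ (p + 1) - a ^ (p + 1)) / (p + 1).factorial : ℝ) : 𝕜)‖
      ≤ B * |b - a| := by
  have hpoly : (∫ t in a..b, ∑ p ∈ Finset.range K, d p * (t : 𝕜) ^ p / (p.factorial : 𝕜)) =
      ∑ p ∈ Finset.range K, d p * (((b ^ (p + 1) - a ^ (p + 1)) / (p + 1).factorial : ℝ) : 𝕜) := by
    have hi : ∀ p, Continuous fun t : ℝ => d p * (t : 𝕜) ^ p / (p.factorial : 𝕜) := fun p => by
      have := RCLike.continuous_ofReal (K := 𝕜)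
      fun_prop
    rw [intervalIntegral.integral_finsetSum fun p _ => (hi p).intervalIntegrable _ _]
    refine Finset.sum_congr rfl fun p _ => ?_
    have h1 : ∀ t : ℝ, d p * (t : 𝕜) ^ p / (p.factorial : 𝕜) =
        (d p / (p.factorial : 𝕜)) * ((t ^ p : ℝ) : 𝕜) := fun t => by push_cast; ring
    simp only [h1]
    rw [intervalIntegral.integral_const_mul, intervalIntegral_ofReal, integral_pow]
    have h2 : (p.factorial : 𝕜) ≠ 0 := Nat.cast_ne_zero.mpr p.factorial_ne_zero
    have h3 : (p + 1 : 𝕜) ≠ 0 := by exact_mod_cast p.succ_ne_zero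
    rw [Nat.factorial_succ]
    push_cast
    field_simp
  have hc : Continuous fun t : ℝ => ∑ p ∈ Finset.range K, d p * (t : 𝕜) ^ p / (p.factorial : 𝕜) := by
    have := RCLike.continuous_ofReal (K := 𝕜)
    fun_prop
  rw [← hpoly, ← intervalIntegral.integral_sub hg.intervalIntegrable (hc.intervalIntegrable _ _)]
  exact intervalIntegral.norm_integral_le_of_norm_le_const fun t ht =>
    h t (Set.uIoc_subset_uIcc ht)

/-! ### The collocation matrix in the flat limit -/

/-- The pairs of natural numbers with sum less than `K`. -/
def lowPairs (K : ℕ) : Finset (ℕ × ℕ) :=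
  (Finset.range K ×ˢ Finset.range K).filter fun x => x.1 + x.2 < K

theorem mem_lowPairs {K : ℕ} {x : ℕ × ℕ} : x ∈ lowPairs K ↔ x.1 + x.2 < K := by
  simp only [lowPairs, Finset.mem_filter, Finset.mem_product, Finset.mem_range]
  omega

/-- The moments `μ i p` of `n` functionals are bounded along the filter, and so is the inverse `E`
of the matrix of the moments of order less than `n`. -/
structure BoundedUnisolvent {T 𝕜 : Type*} [RCLike 𝕜] {n : ℕ} (F : Filter T)
    (μ : T → Fin n → ℕ → 𝕜) (E : T → Matrix (Fin n) (Fin n) 𝕜) : Prop where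
  moment : ∀ i p, (fun t => μ t i p) =O[F] fun _ => (1 : 𝕜)
  inv : ∀ p i, (fun t => E t p i) =O[F] fun _ => (1 : 𝕜)
  mul : ∀ᶠ t in F, E t * Matrix.of (fun i (p : Fin n) => μ t i p) = 1

section

variable {T 𝕜 : Type*} [RCLike 𝕜] {n : ℕ} {F : Filter T}

theorem isBigO_one_mul {f g k : T → 𝕜} (hf : f =O[F] fun _ => (1 : 𝕜)) (hg : g =O[F] k) :
    (fun t => f t * g t) =O[F] k := by
  simpa using hf.mul hg

theorem isBigO_mul_one {f g k : T → 𝕜} (hf : f =O[F] k) (hg : g =O[F] fun _ => (1 : 𝕜)) :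
    (fun t => f t * g t) =O[F] k := by
  simpa using hf.mul hg

theorem isBigO_pow_le {ε : T → 𝕜} (hε : ε =O[F] fun _ => (1 : 𝕜)) {a b : ℕ} (h : a ≤ b) :
    (fun t => ε t ^ b) =O[F] fun t => ε t ^ a := by
  obtain ⟨c, rfl⟩ := Nat.exists_eq_add_of_le h
  simp only [pow_add]
  exact isBigO_mul_one (isBigO_refl _ _) (by simpa using hε.pow c)

theorem isBigO_div_pow {ε f : T → 𝕜} (hε0 : ∀ᶠ t in F, ε t ≠ 0) {a b : ℕ}
    (h : f =O[F] fun t => ε t ^ (a + b)) : (fun t => f t / ε t ^ a) =O[F] fun t => ε t ^ b := by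
  have h1 := h.mul (isBigO_refl (fun t => (ε t ^ a)⁻¹) F)
  refine (h1.congr' ?_ ?_)
  · exact Eventually.of_forall fun t => by simp [div_eq_mul_inv]
  · filter_upwards [hε0] with t ht
    rw [pow_add]
    field_simp

theorem isBigO_of_eventually_zero {f g : T → 𝕜} (h : ∀ᶠ t in F, f t = 0) : f =O[F] g :=
  (isBigO_zero g F).congr' (h.mono fun _ ht => ht.symm) EventuallyEq.rfl

theorem BoundedUnisolvent.sum_eq {μ : T → Fin n → ℕ → 𝕜} {E : T → Matrix (Fin n) (Fin n) 𝕜}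
    (h : BoundedUnisolvent F μ E) :
    ∀ᶠ t in F, ∀ (p' : Fin n) (p : ℕ), p < n →
      ∑ i, E t p' i * μ t i p = if p = p' then 1 else 0 := by
  filter_upwards [h.mul] with t ht p' p hp
  have := congrFun (congrFun ht p') ⟨p, hp⟩
  rw [Matrix.mul_apply] at this
  simp only [Matrix.of_apply] at this
  rw [this, Matrix.one_apply]
  simp [Fin.ext_iff, eq_comm]

theorem BoundedUnisolvent.sum_isBigO {μ : T → Fin n → ℕ → 𝕜} {E : T → Matrix (Fin n) (Fin n) 𝕜}
    (h : BoundedUnisolvent F μ E) (p' : Fin n) (p : ℕ) :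
    (fun t => ∑ i, E t p' i * μ t i p) =O[F] fun _ => (1 : 𝕜) :=
  IsBigO.fun_sum fun i _ => isBigO_one_mul (h.inv p' i) (h.moment i p)

/-- In degrees below n the matrix E inverts the moments and the difference vanishes exactly; from
degree n on, p > p' leaves a spare factor ε. -/
theorem BoundedUnisolvent.scaled {μ : T → Fin n → ℕ → 𝕜} {E : T → Matrix (Fin n) (Fin n) 𝕜}
    (h : BoundedUnisolvent F μ E) {ε : T → 𝕜} (hε : ε =O[F] fun _ => (1 : 𝕜))
    (hε0 : ∀ᶠ t in F, ε t ≠ 0) (p' : Fin n) (p : ℕ) :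
    (fun t => (∑ i, E t p' i * μ t i p) * ε t ^ p / ε t ^ (p' : ℕ) - if p = p' then 1 else 0)
      =O[F] ε := by
  by_cases hp : p < n
  · apply isBigO_of_eventually_zero
    filter_upwards [h.sum_eq, hε0] with t ht h0
    rw [ht p' p hp]
    split_ifs with hpp
    · subst hpp; field_simp; simp
    · simp
  · have hne : p ≠ p' := by have := p'.2; omega
    simp only [if_neg hne, sub_zero]
    have h1 : (fun t => (∑ i, E t p' i * μ t i p) * ε t ^ p) =O[F] fun t => ε t ^ ((p' : ℕ) + 1) :=
      isBigO_one_mul (h.sum_isBigO p' p) (isBigO_pow_le hε (by have := p'.2; omega))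
    simpa using isBigO_div_pow hε0 h1

/-- Both factors are concentrated in one degree up to O(ε), so only the pair (p₀, q₀) survives; `hK`
keeps it inside the truncated sum. -/
theorem sum_lowPairs_sub_isBigO {ε : T → 𝕜} (hε : ε =O[F] fun _ => (1 : 𝕜)) {K p₀ q₀ : ℕ}
    (hK : p₀ + q₀ < K) (φ : ℕ → 𝕜) {a g : T → ℕ → 𝕜} {a₀ : T → 𝕜}
    (ha₀ : a₀ =O[F] fun _ => (1 : 𝕜))
    (ha : ∀ p, (fun t => a t p - if p = p₀ then a₀ t else 0) =O[F] ε)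
    (hg : ∀ q, (fun t => g t q - if q = q₀ then 1 else 0) =O[F] ε) :
    (fun t => (∑ x ∈ lowPairs K, φ (x.1 + x.2) * (a t x.1 * g t x.2)) - φ (p₀ + q₀) * a₀ t)
      =O[F] ε := by
  have hmain : ∀ t, φ (p₀ + q₀) * a₀ t = ∑ x ∈ lowPairs K, φ (x.1 + x.2) *
      ((if x.1 = p₀ then a₀ t else 0) * if x.2 = q₀ then 1 else 0) := fun t => by
    rw [Finset.sum_eq_single (p₀, q₀)]
    · simp
    · rintro ⟨p, q⟩ - hne
      by_cases h1 : p = p₀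
      · have h2 : q ≠ q₀ := fun h2 => hne (by rw [h1, h2])
        simp [h2]
      · simp [h1]
    · intro h; exact absurd (mem_lowPairs.mpr hK) h
  simp only [hmain, ← Finset.sum_sub_distrib, ← mul_sub]
  refine IsBigO.fun_sum fun x _ => IsBigO.const_mul_left ?_ _
  have e : ∀ t, a t x.1 * g t x.2 - (if x.1 = p₀ then a₀ t else 0) * (if x.2 = q₀ then 1 else 0) =
      (a t x.1 - if x.1 = p₀ then a₀ t else 0) * (g t x.2 - if x.2 = q₀ then 1 else 0) +
      (a t x.1 - if x.1 = p₀ then a₀ t else 0) * (if x.2 = q₀ then 1 else 0) +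
      (if x.1 = p₀ then a₀ t else 0) * (g t x.2 - if x.2 = q₀ then 1 else 0) := fun t => by ring
  simp only [e]
  refine ((isBigO_mul_one (ha _) ((hg _).trans hε)).add
    (isBigO_mul_one (ha _) (isBigO_const_const _ one_ne_zero _))).add (isBigO_one_mul ?_ (hg _))
  split_ifs
  · exact ha₀
  · exact isBigO_zero _ _

/-- The leading coefficient of a row of a matrix `φ (ε (y - c))`, in the coordinates dual to the
monomials. -/
theorem row_isBigO {ε : T → 𝕜} (hε : ε =O[F] fun _ => (1 : 𝕜)) (hε0 : ∀ᶠ t in F, ε t ≠ 0)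
    {p₀ : ℕ} (hp₀ : p₀ ≤ n) (φ : ℕ → 𝕜) {γ : T → Fin n → ℕ → 𝕜}
    {C : T → Matrix (Fin n) (Fin n) 𝕜} (hγ : BoundedUnisolvent F γ C) {ρ : T → ℕ → 𝕜}
    {a₀ : T → 𝕜} (ha₀ : a₀ =O[F] fun _ => (1 : 𝕜))
    (hρ : ∀ p, (fun t => ρ t p * ε t ^ p / ε t ^ p₀ - if p = p₀ then a₀ t else 0) =O[F] ε)
    {b : T → Fin n → 𝕜}
    (hb : ∀ k, (fun t => b t k - ∑ x ∈ lowPairs (2 * n), φ (x.1 + x.2) * ε t ^ (x.1 + x.2) *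
      (ρ t x.1 * γ t k x.2)) =O[F] fun t => ε t ^ (2 * n)) (q : Fin n) :
    (fun t => (∑ k, b t k * C t q k) / (ε t ^ p₀ * ε t ^ (q : ℕ)) - φ (p₀ + q) * a₀ t) =O[F] ε := by
  have hmain := sum_lowPairs_sub_isBigO hε (K := 2 * n) (p₀ := p₀) (q₀ := q)
    (by have := q.2; omega) φ ha₀ hρ (hγ.scaled hε hε0 q)
  -- Truncation at total degree 2n suffices: p₀ ≤ n and q ≤ n - 1, so the division leaves at least
  -- one factor ε.
  have hrem : (fun t => (∑ k, (b t k - ∑ x ∈ lowPairs (2 * n), φ (x.1 + x.2) *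
      ε t ^ (x.1 + x.2) * (ρ t x.1 * γ t k x.2)) * C t q k) / ε t ^ (p₀ + q)) =O[F] ε := by
    have h1 : (fun t => ∑ k, (b t k - ∑ x ∈ lowPairs (2 * n), φ (x.1 + x.2) *
      ε t ^ (x.1 + x.2) * (ρ t x.1 * γ t k x.2)) * C t q k) =O[F] fun t => ε t ^ (2 * n) :=
      IsBigO.fun_sum fun k _ => isBigO_mul_one (hb k) (hγ.inv q k)
    have h2 := isBigO_div_pow hε0 (a := p₀ + q) (b := 1)
      (h1.trans (isBigO_pow_le hε (by have := q.2; omega)))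
    simpa using h2
  refine (hrem.add hmain).congr' ?_ EventuallyEq.rfl
  filter_upwards [hε0] with t h0
  have e : ∑ x ∈ lowPairs (2 * n), φ (x.1 + x.2) * (ρ t x.1 * ε t ^ x.1 / ε t ^ p₀ *
      ((∑ i, C t q i * γ t i x.2) * ε t ^ x.2 / ε t ^ (q : ℕ))) =
      (∑ k, (∑ x ∈ lowPairs (2 * n), φ (x.1 + x.2) *
      ε t ^ (x.1 + x.2) * (ρ t x.1 * γ t k x.2)) * C t q k) / ε t ^ (p₀ + q) := by
    simp only [Finset.sum_mul, Finset.mul_sum, Finset.sum_div]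
    rw [Finset.sum_comm]
    refine Finset.sum_congr rfl fun k _ => Finset.sum_congr rfl fun x _ => ?_
    rw [pow_add, pow_add]; field_simp
  rw [e, ← pow_add]
  simp only [sub_mul, Finset.sum_sub_distrib]
  ring

/-- Determinant and adjugate are continuous, so the inverse converges along with K. -/
theorem isBigO_inv_of_isBigO_sub {ε : T → 𝕜} (hε : Tendsto ε F (𝓝 0))
    {K : T → Matrix (Fin n) (Fin n) 𝕜} {K₀ : Matrix (Fin n) (Fin n) 𝕜} (hK₀ : K₀.det ≠ 0)
    (hK : ∀ p q, (fun t => K t p q - K₀ p q) =O[F] ε) :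
    (∀ᶠ t in F, (K t).det ≠ 0) ∧ ∀ p q, (fun t => (K t)⁻¹ p q) =O[F] fun _ => (1 : 𝕜) := by
  have hlim : Tendsto K F (𝓝 K₀) := by
    refine tendsto_pi_nhds.mpr fun p => tendsto_pi_nhds.mpr fun q => ?_
    exact tendsto_sub_nhds_zero_iff.mp ((hK p q).trans_tendsto hε)
  have hdet : Tendsto (fun t => (K t).det) F (𝓝 K₀.det) :=
    ((continuous_id.matrix_det (n := Fin n) (R := 𝕜)).tendsto K₀).comp hlim
  refine ⟨hdet.eventually_ne hK₀, fun p q => ?_⟩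
  have hadj : Tendsto (fun t => (K t).adjugate p q) F (𝓝 (K₀.adjugate p q)) := by
    have h1 := ((continuous_id.matrix_adjugate (n := Fin n) (R := 𝕜)).tendsto K₀).comp hlim
    exact tendsto_pi_nhds.mp (tendsto_pi_nhds.mp h1 p) q
  have h2 := ((hdet.inv₀ hK₀).mul hadj).isBigO_one 𝕜
  refine h2.congr_left fun t => ?_
  simp [Matrix.inv_def, Ring.inverse_eq_inv']

end

/-! ### Leading error term of collocation in the flat limit -/

section

variable {T 𝕜 : Type*} [RCLike 𝕜] {n : ℕ} {F : Filter T}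

/-- The error on the monomial of degree `p` of the reconstruction which is exact on the polynomials
of degree less than `n`. -/
def momentError (τ : ℕ → 𝕜) (μ : Fin n → ℕ → 𝕜) (E : Matrix (Fin n) (Fin n) 𝕜) (p : ℕ) : 𝕜 :=
  τ p - ∑ i, (∑ p' : Fin n, τ p' * E p' i) * μ i p

theorem momentError_isBigO {τ : ℕ → 𝕜} {μ : T → Fin n → ℕ → 𝕜} {E : T → Matrix (Fin n) (Fin n) 𝕜}
    (hμ : BoundedUnisolvent F μ E) (p : ℕ) :
    (fun t => momentError τ (μ t) (E t) p) =O[F] fun _ => (1 : 𝕜) :=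
  (isBigO_const_const _ one_ne_zero _).sub <| IsBigO.fun_sum fun i _ =>
    isBigO_one_mul (IsBigO.fun_sum fun p' _ => (hμ.inv p' i).const_mul_left _) (hμ.moment i p)

theorem momentError_eq_zero {τ : ℕ → 𝕜} {μ : T → Fin n → ℕ → 𝕜}
    {E : T → Matrix (Fin n) (Fin n) 𝕜} (hμ : BoundedUnisolvent F μ E) :
    ∀ᶠ t in F, ∀ p < n, momentError τ (μ t) (E t) p = 0 := by
  filter_upwards [hμ.sum_eq] with t ht p hp
  rw [momentError]
  simp only [Finset.sum_mul]
  rw [Finset.sum_comm]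
  have : ∀ p' : Fin n, ∑ i, τ p' * E t p' i * μ t i p = if p' = ⟨p, hp⟩ then τ p' else 0 :=
    fun p' => by
      simp only [mul_assoc, ← Finset.mul_sum, ht p' p hp, Fin.ext_iff]
      by_cases h : p = p' <;> simp [h, eq_comm]
  simp [this]

/-- Exactness kills the degrees below n, so n is the leading degree of the error and higher degrees
carry a spare ε. -/
theorem momentError_scaled {τ : ℕ → 𝕜} {μ : T → Fin n → ℕ → 𝕜}
    {E : T → Matrix (Fin n) (Fin n) 𝕜} (hμ : BoundedUnisolvent F μ E) {ε : T → 𝕜}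
    (hε : ε =O[F] fun _ => (1 : 𝕜)) (hε0 : ∀ᶠ t in F, ε t ≠ 0) (p : ℕ) :
    (fun t => momentError τ (μ t) (E t) p * ε t ^ p / ε t ^ n -
      if p = n then momentError τ (μ t) (E t) n else 0) =O[F] ε := by
  rcases lt_trichotomy p n with hp | rfl | hp
  · apply isBigO_of_eventually_zero
    filter_upwards [momentError_eq_zero (τ := τ) hμ] with t ht
    simp [ht p hp, hp.ne]
  · apply isBigO_of_eventually_zero
    filter_upwards [hε0] with t ht
    simp [ht]
  · simp only [if_neg hp.ne', sub_zero]
    have h1 : (fun t => momentError τ (μ t) (E t) p * ε t ^ p) =O[F] fun t => ε t ^ (n + 1) :=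
      isBigO_one_mul (momentError_isBigO hμ p) (isBigO_pow_le hε hp)
    simpa using isBigO_div_pow hε0 h1

/-- Collocation with basis functions `φ (ε (y - c))` in the limit `ε → 0`: the linear system becomes
solvable, and the weights `w` of the approximant have an explicit leading error term. -/
theorem exists_weights_isBigO (φ : ℕ → 𝕜)
    (hdet : (Matrix.of fun i j : Fin n => φ ((i : ℕ) + j)).det ≠ 0)
    {c : Fin n → 𝕜} (hc : ∀ q : Fin n, ∑ p : Fin n, c p * φ ((p : ℕ) + q) = φ (n + q))
    {l η : T → 𝕜} (hη : Tendsto η F (𝓝 0)) (hη0 : ∀ᶠ t in F, η t ≠ 0)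
    (hl : l =O[F] fun _ => (1 : 𝕜)) (hl0 : ∀ᶠ t in F, l t ≠ 0)
    {μ : T → Fin n → ℕ → 𝕜} {E : T → Matrix (Fin n) (Fin n) 𝕜} (hμ : BoundedUnisolvent F μ E)
    {γ : T → Fin n → ℕ → 𝕜} {C : T → Matrix (Fin n) (Fin n) 𝕜} (hγ : BoundedUnisolvent F γ C)
    (τ : ℕ → 𝕜) {A : T → Matrix (Fin n) (Fin n) 𝕜} {b v : T → Fin n → 𝕜} {f : T → ℕ → 𝕜}
    (hf : ∀ p, (fun t => f t p) =O[F] fun _ => (1 : 𝕜))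
    (hA : ∀ i k, (fun t => A t i k - ∑ x ∈ lowPairs (2 * n), φ (x.1 + x.2) *
      (l t * η t) ^ (x.1 + x.2) * (μ t i x.1 * γ t k x.2)) =O[F] fun t => (l t * η t) ^ (2 * n))
    (hb : ∀ k, (fun t => b t k - ∑ x ∈ lowPairs (2 * n), φ (x.1 + x.2) *
      (l t * η t) ^ (x.1 + x.2) * (τ x.1 * γ t k x.2)) =O[F] fun t => (l t * η t) ^ (2 * n))
    (hv : ∀ i, (fun t => v t i - ∑ p ∈ Finset.range (n + 1), η t ^ p * f t p * μ t i p)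
      =O[F] fun t => η t ^ (n + 1)) :
    ∃ w : T → Fin n → 𝕜, (∀ᶠ t in F, (A t).det ≠ 0 ∧ Matrix.vecMul (w t) (A t) = b t) ∧
      (fun t => w t ⬝ᵥ v t - (∑ p ∈ Finset.range (n + 1), τ p * (η t ^ p * f t p) -
        momentError τ (μ t) (E t) n * η t ^ n *
          (f t n - ∑ p : Fin n, c p * l t ^ (n - (p : ℕ)) * f t p)))
      =O[F] fun t => η t ^ (n + 1) := by
  set ε : T → 𝕜 := fun t => l t * η t with hεdef
  have hη1 : η =O[F] fun _ => (1 : 𝕜) := hη.isBigO_one 𝕜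
  have hεη : ε =O[F] η := isBigO_one_mul hl (isBigO_refl _ _)
  have hε : ε =O[F] fun _ => (1 : 𝕜) := hεη.trans hη1
  have hεt : Tendsto ε F (𝓝 0) := hεη.trans_tendsto hη
  have hε0 : ∀ᶠ t in F, ε t ≠ 0 := by
    filter_upwards [hη0, hl0] with t h1 h2 using mul_ne_zero h2 h1
  set R : T → ℕ → 𝕜 := fun t p => momentError τ (μ t) (E t) p with hR
  -- The weights of the polynomial reconstruction exact in degrees below n.
  set κ : T → Fin n → 𝕜 := fun t i => ∑ p' : Fin n, τ p' * E t p' i with hκ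
  have hκ1 : ∀ i, (fun t => κ t i) =O[F] fun _ => (1 : 𝕜) := fun i =>
    IsBigO.fun_sum fun p' _ => (hμ.inv p' i).const_mul_left _
  -- E A Cᵀ with the powers of ε stripped from rows and columns; its limit is the Hankel matrix.
  set K : T → Matrix (Fin n) (Fin n) 𝕜 := fun t => Matrix.of fun p q =>
    (∑ k, (∑ i, E t p i * A t i k) * C t q k) / (ε t ^ (p : ℕ) * ε t ^ (q : ℕ)) with hKdef
  -- The residual of κ in the same coordinates. It starts in degree n, which permits division by
  -- ε^n.
  set r : T → Fin n → 𝕜 := fun t q =>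
    (∑ k, (b t k - ∑ i, κ t i * A t i k) * C t q k) / (ε t ^ n * ε t ^ (q : ℕ)) with hrdef
  have hK : ∀ p q, (fun t => K t p q - Matrix.of (fun i j : Fin n => φ ((i : ℕ) + j)) p q)
      =O[F] ε := fun p q => by
    have := row_isBigO hε hε0 p.2.le φ hγ (ρ := fun t m => ∑ i, E t p i * μ t i m)
      (a₀ := fun _ => 1) (isBigO_refl _ _) (hμ.scaled hε hε0 p)
      (b := fun t k => ∑ i, E t p i * A t i k) (fun k => ?_) q
    · simpa [hKdef] using this
    · have h1 := IsBigO.fun_sum (s := Finset.univ) fun i _ => isBigO_one_mul (hμ.inv p i) (hA i k)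
      refine h1.congr_left fun t => ?_
      simp only [mul_sub, Finset.sum_sub_distrib, Finset.mul_sum, Finset.sum_mul]
      rw [Finset.sum_comm]
      congr 1
      refine Finset.sum_congr rfl fun x _ => Finset.sum_congr rfl fun i _ => by ring
  have hr : ∀ q, (fun t => r t q - φ (n + q) * R t n) =O[F] ε := fun q => by
    refine row_isBigO hε hε0 le_rfl φ hγ (ρ := R)
      (a₀ := fun t => R t n) (momentError_isBigO hμ n) (momentError_scaled hμ hε hε0)
      (b := fun t k => b t k - ∑ i, κ t i * A t i k) (fun k => ?_) q
    have h1 := (hb k).sub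
      (IsBigO.fun_sum (s := Finset.univ) fun i _ => isBigO_one_mul (hκ1 i) (hA i k))
    refine h1.congr_left fun t => ?_
    simp only [mul_sub, Finset.sum_sub_distrib, hR, momentError, Finset.mul_sum, sub_mul]
    have e : ∑ x ∈ lowPairs (2 * n), φ (x.1 + x.2) * (l t * η t) ^ (x.1 + x.2) *
        ((∑ i, κ t i * μ t i x.1) * γ t k x.2) =
        ∑ i, ∑ x ∈ lowPairs (2 * n), κ t i * (φ (x.1 + x.2) * (l t * η t) ^ (x.1 + x.2) *
          (μ t i x.1 * γ t k x.2)) := by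
      simp only [Finset.sum_mul, Finset.mul_sum]
      rw [Finset.sum_comm]
      refine Finset.sum_congr rfl fun x _ => Finset.sum_congr rfl fun i _ => by ring
    simp only [hεdef]
    rw [← e]
    ring
  obtain ⟨hKdet, hKinv⟩ := isBigO_inv_of_isBigO_sub hεt hdet hK
  set X : T → Fin n → 𝕜 := fun t => Matrix.vecMul (r t) (K t)⁻¹ with hX
  -- X - R c = (r - R c K) K⁻¹, and the bracket is O(ε) because c maps the Hankel matrix to the
  -- limit φ(n + q) of r / R (compared without dividing by R).
  have hXlim : ∀ p, (fun t => X t p - R t n * c p) =O[F] ε := fun p => by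
    have h1 : ∀ q, (fun t => (r t q - φ (n + q) * R t n) - ∑ p', R t n * (c p' *
        (K t p' q - Matrix.of (fun i j : Fin n => φ ((i : ℕ) + j)) p' q))) =O[F] ε := fun q =>
      (hr q).sub (IsBigO.fun_sum fun p' _ => isBigO_one_mul (momentError_isBigO hμ n)
        ((hK p' q).const_mul_left _))
    have h2 := IsBigO.fun_sum (s := Finset.univ) fun q _ => isBigO_mul_one (h1 q) (hKinv q p)
    refine h2.congr' ?_ EventuallyEq.rfl
    filter_upwards [hKdet] with t hd
    have e1 : ∀ q, (r t q - φ (n + q) * R t n) - ∑ p', R t n * (c p' *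
        (K t p' q - Matrix.of (fun i j : Fin n => φ ((i : ℕ) + j)) p' q)) =
        (r t - R t n • Matrix.vecMul c (K t)) q := fun q => by
      rw [← hc q]
      simp only [Matrix.of_apply, mul_sub, Finset.sum_sub_distrib, Finset.sum_mul, Pi.sub_apply,
        Pi.smul_apply, smul_eq_mul, Matrix.vecMul, dotProduct, Finset.mul_sum]
      have : ∀ x : Fin n, c x * φ ((x : ℕ) + q) * R t n = R t n * (c x * φ ((x : ℕ) + q)) :=
        fun x => by ring
      simp only [this]
      ring
    simp only [e1]
    have e2 : X t - R t n • c = Matrix.vecMul (r t - R t n • Matrix.vecMul c (K t)) (K t)⁻¹ := by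
      rw [Matrix.sub_vecMul, Matrix.smul_vecMul, Matrix.vecMul_vecMul,
        Matrix.mul_nonsing_inv _ (isUnit_iff_ne_zero.mpr hd), Matrix.vecMul_one]
    have := congrFun e2 p
    simp only [Pi.sub_apply, Pi.smul_apply, smul_eq_mul] at this
    rw [this]
    rfl
  -- w = κ + ε^n X D⁻¹ E: the polynomial weights plus the exact correction that cancels their
  -- residual.
  refine ⟨fun t i => κ t i + ∑ p : Fin n, ε t ^ n / ε t ^ (p : ℕ) * X t p * E t p i, ?_, ?_⟩
  · filter_upwards [hKdet, hε0, hγ.mul] with t hd h0 hCt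
    set D : Matrix (Fin n) (Fin n) 𝕜 := Matrix.diagonal fun p => ε t ^ (p : ℕ) with hD
    have hfac : E t * A t * (C t).transpose = D * K t * D := by
      ext p q
      rw [hD, Matrix.mul_diagonal, Matrix.diagonal_mul]
      simp only [hKdef, Matrix.of_apply, Matrix.mul_apply, Matrix.transpose_apply]
      field_simp
    have hrr : Matrix.vecMul (b t - Matrix.vecMul (κ t) (A t)) (C t).transpose =
        ε t ^ n • Matrix.vecMul (r t) D := by
      ext q
      rw [hD, Pi.smul_apply, Matrix.vecMul_diagonal]
      simp only [hrdef, Matrix.vecMul, dotProduct, Matrix.transpose_apply, Pi.sub_apply, smul_eq_mul]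
      field_simp
    have hDdet : D.det ≠ 0 := by
      rw [hD, Matrix.det_diagonal]
      exact Finset.prod_ne_zero_iff.mpr fun p _ => pow_ne_zero _ h0
    constructor
    · intro hA0
      have := congrArg Matrix.det hfac
      simp only [Matrix.det_mul, hA0, mul_zero, zero_mul] at this
      exact mul_ne_zero (mul_ne_zero hDdet hd) hDdet this.symm
    · have hw : (fun i => κ t i + ∑ p : Fin n, ε t ^ n / ε t ^ (p : ℕ) * X t p * E t p i) =
          κ t + ε t ^ n • Matrix.vecMul (Matrix.vecMul (X t) D⁻¹) (E t) := by
        have hDi : D⁻¹ = Matrix.diagonal fun p : Fin n => (ε t ^ (p : ℕ))⁻¹ := by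
          apply Matrix.inv_eq_left_inv
          rw [hD, Matrix.diagonal_mul_diagonal, ← Matrix.diagonal_one]
          congr 1
          ext p
          exact inv_mul_cancel₀ (pow_ne_zero _ h0)
        ext i
        rw [hDi]
        simp only [Pi.add_apply, Pi.smul_apply, smul_eq_mul, Matrix.vecMul, dotProduct,
          Finset.mul_sum]
        congr 1
        refine Finset.sum_congr rfl fun p _ => ?_
        have e : ∑ x, X t x * Matrix.diagonal (fun p : Fin n => (ε t ^ (p : ℕ))⁻¹) x p =
            X t p * (ε t ^ (p : ℕ))⁻¹ := Matrix.vecMul_diagonal (X t) _ p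
        rw [e]
        ring
      rw [hw]
      have h1 : Matrix.vecMul (Matrix.vecMul (κ t + ε t ^ n • Matrix.vecMul (Matrix.vecMul (X t) D⁻¹)
          (E t)) (A t) - b t) (C t).transpose = 0 := by
        have h2 : Matrix.vecMul (Matrix.vecMul (Matrix.vecMul (Matrix.vecMul (X t) D⁻¹) (E t)) (A t))
            (C t).transpose = Matrix.vecMul (r t) D := by
          simp only [Matrix.vecMul_vecMul, hX]
          rw [show (K t)⁻¹ * D⁻¹ * E t * A t * (C t).transpose =
            (K t)⁻¹ * (D⁻¹ * (E t * A t * (C t).transpose)) by simp only [Matrix.mul_assoc], hfac,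
            Matrix.mul_assoc D, ← Matrix.mul_assoc D⁻¹,
            Matrix.nonsing_inv_mul _ (isUnit_iff_ne_zero.mpr hDdet), Matrix.one_mul,
            ← Matrix.mul_assoc, Matrix.nonsing_inv_mul _ (isUnit_iff_ne_zero.mpr hd),
            Matrix.one_mul]
        rw [Matrix.add_vecMul, add_sub_right_comm, Matrix.add_vecMul, Matrix.smul_vecMul,
          Matrix.smul_vecMul, h2, ← hrr, ← Matrix.add_vecMul]
        simp
      -- Cᵀ is invertible, so the equation w A = b follows from its image under Cᵀ.
      have hC2 : (C t).transpose * (Matrix.of fun i (p : Fin n) => γ t i p).transpose = 1 := by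
        rw [← Matrix.transpose_mul, mul_eq_one_comm.mp hCt, Matrix.transpose_one]
      have h3 := congrArg (fun y => Matrix.vecMul y
        (Matrix.of fun i (p : Fin n) => γ t i p).transpose) h1
      simp only [Matrix.vecMul_vecMul, hC2, Matrix.vecMul_one, Matrix.zero_vecMul] at h3
      simpa only [Matrix.vecMul_vecMul] using sub_eq_zero.mp h3
  -- The data in dual coordinates: z_p recovers the Taylor term η^p f_p, up to a contribution of
  -- degree n.
  · set z : T → Fin n → 𝕜 := fun t p => ∑ i, E t p i * v t i with hz
    have hz1 : ∀ p : Fin n, (fun t => z t p - (η t ^ (p : ℕ) * f t p +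
        η t ^ n * f t n * ∑ i, E t p i * μ t i n)) =O[F] fun t => η t ^ (n + 1) := fun p => by
      have h1 := IsBigO.fun_sum (s := Finset.univ) fun i _ => isBigO_one_mul (hμ.inv p i) (hv i)
      refine h1.congr' ?_ EventuallyEq.rfl
      filter_upwards [hμ.sum_eq] with t ht
      simp only [mul_sub, Finset.sum_sub_distrib, hz]
      congr 1
      simp only [Finset.sum_range_succ, mul_add, Finset.sum_add_distrib, Finset.mul_sum]
      congr 1
      · rw [Finset.sum_comm]
        have e : ∀ m ∈ Finset.range n, ∑ i, E t p i * (η t ^ m * f t m * μ t i m) =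
            if m = p then η t ^ m * f t m else 0 := fun m hm => by
          have h5 := ht p m (Finset.mem_range.mp hm)
          have : ∀ i, E t p i * (η t ^ m * f t m * μ t i m) =
            (η t ^ m * f t m) * (E t p i * μ t i m) := fun i => by ring
          simp only [this, ← Finset.mul_sum, h5]
          split_ifs <;> simp
        rw [Finset.sum_congr rfl e, Finset.sum_ite_eq' (Finset.range n) (p : ℕ)]
        simp
      · refine Finset.sum_congr rfl fun i _ => by ring
    have hz2 : ∀ p : Fin n, (fun t => z t p - η t ^ (p : ℕ) * f t p) =O[F] fun t => η t ^ n :=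
      fun p => by
        have h1 : (fun t => η t ^ n * f t n * ∑ i, E t p i * μ t i n) =O[F] fun t => η t ^ n :=
          isBigO_mul_one (isBigO_mul_one (isBigO_refl _ _) (hf n)) (hμ.sum_isBigO p n)
        refine (((hz1 p).trans (isBigO_pow_le hη1 n.le_succ)).add h1).congr_left fun t => by ring
    have hz3 : ∀ p : Fin n, (fun t => z t p) =O[F] fun t => η t ^ (p : ℕ) := fun p => by
      refine (((hz2 p).trans (isBigO_pow_le hη1 p.2.le)).add
        (isBigO_mul_one (isBigO_refl (fun t => η t ^ (p : ℕ)) F) (hf p))).congr_left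
        fun t => by ring
    -- Since ε^n / ε^p = (lη)^(n-p) and z_p = O(η^p), the correction has order η^n; replacing X_p
    -- and z_p by their leading parts costs one more factor η.
    have hY : ∀ p : Fin n, (fun t => l t ^ (n - (p : ℕ)) * (η t ^ (n - (p : ℕ)) *
        ((X t p - R t n * c p) * z t p + R t n * (c p * (z t p - η t ^ (p : ℕ) * f t p)))))
        =O[F] fun t => η t ^ (n + 1) := fun p => by
      have hp := p.2
      have h1 : (fun t => (X t p - R t n * c p) * z t p + R t n * (c p *
          (z t p - η t ^ (p : ℕ) * f t p))) =O[F] fun t => η t ^ ((p : ℕ) + 1) := by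
        refine IsBigO.add ?_ ?_
        · refine (((hXlim p).trans hεη).mul (hz3 p)).congr_right fun t => by ring
        · exact isBigO_one_mul (momentError_isBigO hμ n)
            (((hz2 p).trans (isBigO_pow_le hη1 hp)).const_mul_left _)
      refine isBigO_one_mul (by simpa using hl.pow (n - (p : ℕ))) ?_
      refine ((isBigO_refl (fun t => η t ^ (n - (p : ℕ))) F).mul h1).congr_right fun t => ?_
      rw [← pow_add]; congr 1; omega
    have hZ := (IsBigO.fun_sum (s := Finset.univ) fun p _ => (hz1 p).const_mul_left (τ p)).add
      (IsBigO.fun_sum (s := Finset.univ) fun p _ => hY p)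
    refine hZ.congr' ?_ EventuallyEq.rfl
    filter_upwards [hε0, hη0] with t h0 hη0t
    have e1 : (fun i => κ t i + ∑ p : Fin n, ε t ^ n / ε t ^ (p : ℕ) * X t p * E t p i) ⬝ᵥ v t =
        ∑ p : Fin n, τ p * z t p + ∑ p : Fin n, ε t ^ n / ε t ^ (p : ℕ) * X t p * z t p := by
      simp only [dotProduct, add_mul, Finset.sum_add_distrib, hκ, hz, Finset.sum_mul,
        Finset.mul_sum]
      congr 1
      · rw [Finset.sum_comm]
        refine Finset.sum_congr rfl fun p _ => Finset.sum_congr rfl fun i _ => by ring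
      · rw [Finset.sum_comm]
        refine Finset.sum_congr rfl fun p _ => Finset.sum_congr rfl fun i _ => by ring
    have e2 : ∑ p : Fin n, τ p * ∑ i, E t p i * μ t i n = τ n - R t n := by
      simp only [hR, momentError, sub_sub_cancel, Finset.sum_mul, Finset.mul_sum]
      rw [Finset.sum_comm]
      refine Finset.sum_congr rfl fun p _ => Finset.sum_congr rfl fun i _ => by ring
    have e3 : ∀ p : Fin n, l t ^ (n - (p : ℕ)) * (η t ^ (n - (p : ℕ)) *
        ((X t p - R t n * c p) * z t p + R t n * (c p * (z t p - η t ^ (p : ℕ) * f t p)))) =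
        ε t ^ n / ε t ^ (p : ℕ) * X t p * z t p -
          R t n * η t ^ n * (c p * l t ^ (n - (p : ℕ)) * f t p) := fun p => by
      have h5 : ε t ^ n / ε t ^ (p : ℕ) = l t ^ (n - (p : ℕ)) * η t ^ (n - (p : ℕ)) := by
        rw [← mul_pow, div_eq_iff (pow_ne_zero _ h0), ← pow_add, Nat.sub_add_cancel p.2.le]
      have h6 : η t ^ n = η t ^ (n - (p : ℕ)) * η t ^ (p : ℕ) := by
        rw [← pow_add, Nat.sub_add_cancel p.2.le]
      rw [h5, h6]; ring
    rw [Finset.sum_congr rfl fun p _ => e3 p, e1, show momentError τ (μ t) (E t) n = R t n from rfl]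
    simp only [Finset.sum_sub_distrib, ← Finset.mul_sum, mul_sub, mul_add, Finset.sum_add_distrib]
    have e4 : ∑ p : Fin n, τ p * (η t ^ n * f t n * ∑ i, E t p i * μ t i n) =
        η t ^ n * f t n * (τ n - R t n) := by
      rw [← e2, Finset.mul_sum]
      refine Finset.sum_congr rfl fun p _ => by ring
    rw [e4, Finset.sum_range_succ, ← Fin.sum_univ_eq_sum_range (fun p => τ p * (η t ^ p * f t p))]
    ring

end

/-! ### Unisolvence of the data functionals and the nodal polynomial -/

/-- The value of `y ^ p / p!` at `y`. -/
noncomputable def pointMoment (y : ℝ) (p : ℕ) : ℝ := y ^ p / p.factorial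

/-- The average of `y ^ p / p!` over the cell `[i - θ, i + 1 - θ]`. -/
noncomputable def cellMoment (θ : ℝ) (i p : ℕ) : ℝ :=
  ((i + 1 - θ) ^ (p + 1) - (i - θ) ^ (p + 1)) / (p + 1).factorial

theorem det_pointMoment_ne_zero {n : ℕ} {Y : Fin n → ℝ} (hY : Function.Injective Y) :
    (Matrix.of fun i (p : Fin n) => pointMoment (Y i) p).det ≠ 0 := by
  have h : (Matrix.of fun i (p : Fin n) => pointMoment (Y i) p) =
      Matrix.vandermonde Y * Matrix.diagonal fun p : Fin n => (((p : ℕ).factorial : ℝ))⁻¹ := by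
    ext i p
    simp [pointMoment, Matrix.mul_diagonal, Matrix.vandermonde_apply, div_eq_mul_inv]
  rw [h, Matrix.det_mul, Matrix.det_diagonal]
  refine mul_ne_zero (Matrix.det_vandermonde_ne_zero_iff.mpr hY)
    (Finset.prod_ne_zero_iff.mpr fun p _ => inv_ne_zero ?_)
  exact_mod_cast (p : ℕ).factorial_ne_zero

/-- A kernel vector is a polynomial of degree below N with zero averages. Its antiderivative takes
equal values at all interfaces; subtracting that value gives a polynomial of degree at most N with N
+ 1 zeros, contradicting the Vandermonde determinant. -/
theorem det_cellMoment_ne_zero (N : ℕ) (θ : ℝ) :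
    (Matrix.of fun (i p : Fin N) => cellMoment θ i p).det ≠ 0 := by
  intro h0
  obtain ⟨v, hv0, hv⟩ := Matrix.exists_mulVec_eq_zero_iff.mpr h0
  have hstep : ∀ i : ℕ, i < N → ∑ p : Fin N, pointMoment ((i + 1 : ℕ) - θ) (p + 1) * v p =
      ∑ p : Fin N, pointMoment (i - θ) (p + 1) * v p := fun i hi => by
    have h1 := congrFun hv ⟨i, hi⟩
    simp only [Matrix.mulVec, dotProduct, Matrix.of_apply, Pi.zero_apply] at h1
    rw [← sub_eq_zero, ← Finset.sum_sub_distrib, ← h1]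
    refine Finset.sum_congr rfl fun p _ => ?_
    simp only [pointMoment, cellMoment]
    push_cast
    ring
  have hconst : ∀ i : ℕ, i ≤ N → ∑ p : Fin N, pointMoment (i - θ) (p + 1) * v p =
      ∑ p : Fin N, pointMoment ((0 : ℕ) - θ) (p + 1) * v p := fun i => by
    induction i with
    | zero => intro _; rfl
    | succ i ih => intro hi; rw [hstep i hi, ih (by omega)]
  have hinj : Function.Injective fun i : Fin (N + 1) => ((i : ℕ) : ℝ) - θ := fun i j h => by
    simpa [Fin.ext_iff] using h
  refine det_pointMoment_ne_zero hinj (Matrix.exists_mulVec_eq_zero_iff.mp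
    ⟨Fin.cons (-∑ p : Fin N, pointMoment ((0 : ℕ) - θ) (p + 1) * v p) v, fun hz => ?_, ?_⟩)
  · apply hv0
    ext p
    have := congrFun hz p.succ
    simpa using this
  · ext i
    have := hconst i (by omega)
    simp only [Matrix.mulVec, dotProduct, Matrix.of_apply, Pi.zero_apply, Fin.sum_univ_succ,
      Fin.cons_zero, Fin.cons_succ, Fin.val_succ, this]
    simp [pointMoment]

/-- Compactness in θ: the moments and the inverse moment matrix are continuous in θ, hence bounded
on [a, b]. -/
theorem boundedUnisolvent_of_continuous {T : Type*} (𝕜 : Type*) [RCLike 𝕜] {F : Filter T} {n : ℕ}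
    {m : ℝ → Fin n → ℕ → ℝ} (hm : ∀ i p, Continuous fun θ => m θ i p)
    (hdet : ∀ θ, (Matrix.of fun i (p : Fin n) => m θ i p).det ≠ 0) {θ : T → ℝ} {a b : ℝ}
    (hθ : ∀ᶠ t in F, θ t ∈ Set.Icc a b) :
    BoundedUnisolvent F (fun t i p => (m (θ t) i p : 𝕜))
      (fun t => (Matrix.of fun i (p : Fin n) => m (θ t) i p)⁻¹.map (fun r : ℝ => (r : 𝕜))) := by
  have hbdd : ∀ g : ℝ → ℝ, Continuous g → (fun t => (g (θ t) : 𝕜)) =O[F] fun _ => (1 : 𝕜) :=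
    fun g hg => by
      obtain ⟨B, hB⟩ := (isCompact_Icc (a := a) (b := b)).exists_bound_of_continuousOn hg.continuousOn
      refine IsBigO.of_bound B ?_
      filter_upwards [hθ] with t ht
      simpa using hB _ ht
  refine ⟨fun i p => hbdd _ (hm i p), fun p i => ?_, ?_⟩
  · refine hbdd (fun θ => (Matrix.of fun i (p : Fin n) => m θ i p)⁻¹ p i) ?_
    have hM : Continuous fun θ => (Matrix.of fun i (p : Fin n) => m θ i p) :=
      continuous_matrix fun i p => hm i p
    have h1 := (hM.matrix_det.inv₀ hdet).mul ((hM.matrix_adjugate).matrix_elem p i)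
    refine h1.congr fun θ => ?_
    simp [Matrix.inv_def, Ring.inverse_eq_inv']
  · refine Eventually.of_forall fun t => ?_
    have h1 := Matrix.nonsing_inv_mul _ (isUnit_iff_ne_zero.mpr (hdet (θ t)))
    have h2 := congrArg (fun M : Matrix (Fin n) (Fin n) ℝ => M.map (algebraMap ℝ 𝕜)) h1
    simp only [Matrix.map_mul] at h2
    rw [Matrix.map_one _ (map_zero _) (map_one _)] at h2
    exact h2

theorem boundedUnisolvent_cellMoment {T : Type*} (𝕜 : Type*) [RCLike 𝕜] {F : Filter T} (N : ℕ)
    {θ : T → ℝ} {a b : ℝ} (hθ : ∀ᶠ t in F, θ t ∈ Set.Icc a b) :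
    BoundedUnisolvent F (fun t (i : Fin N) p => (cellMoment (θ t) i p : 𝕜))
      (fun t => (Matrix.of fun (i p : Fin N) => cellMoment (θ t) i p)⁻¹.map
        (fun r : ℝ => (r : 𝕜))) :=
  boundedUnisolvent_of_continuous 𝕜 (m := fun θ i p => cellMoment θ i p)
    (fun i p => by unfold cellMoment; fun_prop) (det_cellMoment_ne_zero N) hθ

theorem boundedUnisolvent_pointMoment {T : Type*} (𝕜 : Type*) [RCLike 𝕜] {F : Filter T} {n : ℕ}
    {Y : ℝ → Fin n → ℝ} (hY : ∀ i, Continuous fun θ => Y θ i)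
    (hinj : ∀ θ, Function.Injective (Y θ)) {θ : T → ℝ} {a b : ℝ}
    (hθ : ∀ᶠ t in F, θ t ∈ Set.Icc a b) :
    BoundedUnisolvent F (fun t i p => (pointMoment (Y (θ t) i) p : 𝕜))
      (fun t => (Matrix.of fun i (p : Fin n) => pointMoment (Y (θ t) i) p)⁻¹.map
        (fun r : ℝ => (r : 𝕜))) :=
  boundedUnisolvent_of_continuous 𝕜 (m := fun θ i p => pointMoment (Y θ i) p)
    (fun i p => by have := hY i; unfold pointMoment; fun_prop)
    (fun θ => det_pointMoment_ne_zero (hinj θ)) hθ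

/-- The nodal polynomial of the interfaces in the coordinate centred at the evaluation point. -/
noncomputable def nodePoly (N : ℕ) (θ : ℝ) : Polynomial ℝ :=
  ∏ k ∈ Finset.range (N + 1), (Polynomial.X - Polynomial.C (k - θ))

theorem nodePoly_monic (N : ℕ) (θ : ℝ) : (nodePoly N θ).Monic :=
  Polynomial.monic_prod_of_monic _ _ fun _ _ => Polynomial.monic_X_sub_C _

theorem nodePoly_natDegree (N : ℕ) (θ : ℝ) : (nodePoly N θ).natDegree = N + 1 := by
  rw [nodePoly, Polynomial.natDegree_prod_of_monic _ _ fun _ _ => Polynomial.monic_X_sub_C _]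
  simp only [Polynomial.natDegree_X_sub_C, Finset.sum_const, Finset.card_range, smul_eq_mul, mul_one]

theorem nodePoly_coeff_top (N : ℕ) (θ : ℝ) : (nodePoly N θ).coeff (N + 1) = 1 := by
  rw [← nodePoly_natDegree N θ]
  exact nodePoly_monic N θ

theorem nodePoly_eval (N : ℕ) (θ : ℝ) {i : ℕ} (hi : i ≤ N) :
    (nodePoly N θ).eval ((i : ℝ) - θ) = 0 := by
  rw [nodePoly, Polynomial.eval_prod]
  exact Finset.prod_eq_zero (Finset.mem_range.mpr (Nat.lt_succ_of_le hi)) (by simp)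

/-- The nodes are shifted by θ, so the derivative at the origin is that of ∏(t - k) at θ. -/
theorem nodePoly_coeff_one (N : ℕ) (θ : ℝ) :
    (nodePoly N θ).coeff 1 / (N + 1).factorial = -positionFactor N θ := by
  have h1 : (nodePoly N θ).coeff 1 = (nodePoly N θ).derivative.eval 0 := by
    rw [← Polynomial.coeff_zero_eq_eval_zero, Polynomial.coeff_derivative]; simp
  have h2 : (fun t : ℝ => ∏ k ∈ Finset.range (N + 1), (t - k)) =
      fun t => (nodePoly N θ).eval (t - θ) := by
    ext t
    rw [nodePoly, Polynomial.eval_prod]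
    refine Finset.prod_congr rfl fun k _ => ?_
    simp
  rw [positionFactor, h2, deriv_comp_sub_const (f := fun t => (nodePoly N θ).eval t),
    Polynomial.deriv, sub_self, h1]
  ring

section

variable {T 𝕜 : Type*} [RCLike 𝕜] {n : ℕ} {F : Filter T}

/-- A polynomial with zero data has zero reconstruction, so its error is its target value. By
exactness in lower degrees, that error also equals the error in degree n, as d_n = 1. -/
theorem momentError_eq_of_annihilator {τ : ℕ → 𝕜} {μ : T → Fin n → ℕ → 𝕜}
    {E : T → Matrix (Fin n) (Fin n) 𝕜} (hμ : BoundedUnisolvent F μ E) {d : T → ℕ → 𝕜}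
    (hd : ∀ t i, ∑ p ∈ Finset.range (n + 1), d t p * μ t i p = 0) (hdn : ∀ t, d t n = 1) :
    ∀ᶠ t in F, momentError τ (μ t) (E t) n = ∑ p ∈ Finset.range (n + 1), d t p * τ p := by
  filter_upwards [momentError_eq_zero (τ := τ) hμ] with t ht
  have h1 : ∑ p ∈ Finset.range (n + 1), d t p * momentError τ (μ t) (E t) p =
      momentError τ (μ t) (E t) n := by
    rw [Finset.sum_range_succ, hdn, one_mul, Finset.sum_eq_zero, zero_add]
    intro p hp
    rw [ht p (Finset.mem_range.mp hp), mul_zero]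
  rw [← h1]
  simp only [momentError, mul_sub, Finset.sum_sub_distrib]
  rw [sub_eq_self]
  simp only [Finset.mul_sum]
  rw [Finset.sum_comm]
  refine Finset.sum_eq_zero fun i _ => ?_
  have : ∀ p, d t p * ((∑ p' : Fin n, τ p' * E t p' i) * μ t i p) =
    (∑ p' : Fin n, τ p' * E t p' i) * (d t p * μ t i p) := fun p => by ring
  simp only [this, ← Finset.mul_sum, hd t i, mul_zero]

/-- The annihilated polynomial is ω'/(N+1)!, with ω the nodal polynomial: its cell averages are
differences of values of ω at interfaces. -/
theorem momentError_cellMoment {N : ℕ} {θ : T → ℝ} {a b : ℝ} (hθ : ∀ᶠ t in F, θ t ∈ Set.Icc a b) :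
    ∀ᶠ t in F, momentError (fun p => if p = 0 then (1 : 𝕜) else 0)
      (fun (i : Fin N) p => (cellMoment (θ t) i p : 𝕜))
      ((Matrix.of fun (i p : Fin N) => cellMoment (θ t) i p)⁻¹.map (fun r : ℝ => (r : 𝕜))) N =
      ((-positionFactor N (θ t) : ℝ) : 𝕜) := by
  have h := momentError_eq_of_annihilator (τ := fun p => if p = 0 then (1 : 𝕜) else 0)
    (boundedUnisolvent_cellMoment 𝕜 (F := F) N hθ)
    (d := fun t p => (((p + 1).factorial * (nodePoly N (θ t)).coeff (p + 1) /
      (N + 1).factorial : ℝ) : 𝕜)) (fun t i => ?_) (fun t => ?_)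
  · filter_upwards [h] with t ht
    rw [ht, ← nodePoly_coeff_one, Finset.sum_range_succ']
    simp
  · have e : ∀ y : ℝ, ∑ p ∈ Finset.range (N + 1), (nodePoly N (θ t)).coeff (p + 1) * y ^ (p + 1) =
        (nodePoly N (θ t)).eval y - (nodePoly N (θ t)).coeff 0 := fun y => by
      rw [Polynomial.eval_eq_sum_range, nodePoly_natDegree, Finset.sum_range_succ' _ (N + 1)]
      simp
    have h0 : ∑ p ∈ Finset.range (N + 1), ((p + 1).factorial * (nodePoly N (θ t)).coeff (p + 1) /
      (N + 1).factorial) * cellMoment (θ t) i p = 0 := by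
      have e1 : ∀ p, ((p + 1).factorial * (nodePoly N (θ t)).coeff (p + 1) /
        (N + 1).factorial) * cellMoment (θ t) i p = ((nodePoly N (θ t)).coeff (p + 1) *
          (((i : ℕ) + 1 : ℕ) - θ t) ^ (p + 1) - (nodePoly N (θ t)).coeff (p + 1) *
          ((i : ℕ) - θ t) ^ (p + 1)) / (N + 1).factorial := fun p => by
        have : ((p + 1).factorial : ℝ) ≠ 0 := by exact_mod_cast (p + 1).factorial_ne_zero
        rw [cellMoment]
        push_cast
        field_simp
      simp only [e1, ← Finset.sum_div, Finset.sum_sub_distrib, e]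
      rw [nodePoly_eval _ _ (by omega), nodePoly_eval _ _ (by omega)]
      simp
    exact_mod_cast congrArg (fun r : ℝ => (r : 𝕜)) h0
  · have : ((N + 1).factorial : ℝ) ≠ 0 := by exact_mod_cast (N + 1).factorial_ne_zero
    rw [nodePoly_coeff_top, mul_one, div_self this, RCLike.ofReal_one]

/-- Here ω/(N+1)! itself is annihilated, and the target is the derivative at 0, so the same factor
results. -/
theorem momentError_pointMoment {N : ℕ} {θ : T → ℝ} {a b : ℝ} (hθ : ∀ᶠ t in F, θ t ∈ Set.Icc a b) :
    ∀ᶠ t in F, momentError (fun p => if p = 1 then (1 : 𝕜) else 0)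
      (fun (i : Fin (N + 1)) p => (pointMoment ((i : ℕ) - θ t) p : 𝕜))
      ((Matrix.of fun (i p : Fin (N + 1)) => pointMoment ((i : ℕ) - θ t) p)⁻¹.map
        (fun r : ℝ => (r : 𝕜))) (N + 1) = ((-positionFactor N (θ t) : ℝ) : 𝕜) := by
  have h := momentError_eq_of_annihilator (τ := fun p => if p = 1 then (1 : 𝕜) else 0)
    (boundedUnisolvent_pointMoment 𝕜 (F := F) (Y := fun θ (i : Fin (N + 1)) => ((i : ℕ) : ℝ) - θ)
      (fun i => by fun_prop) (fun θ i j h => by simpa [Fin.ext_iff] using h) hθ)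
    (d := fun t p => ((p.factorial * (nodePoly N (θ t)).coeff p /
      (N + 1).factorial : ℝ) : 𝕜)) (fun t i => ?_) (fun t => ?_)
  · filter_upwards [h] with t ht
    rw [ht, ← nodePoly_coeff_one, Finset.sum_range_succ', Finset.sum_range_succ']
    simp
  · have h0 : ∑ p ∈ Finset.range (N + 1 + 1), (p.factorial * (nodePoly N (θ t)).coeff p /
      (N + 1).factorial) * pointMoment ((i : ℕ) - θ t) p = 0 := by
      have e1 : ∀ p, (p.factorial * (nodePoly N (θ t)).coeff p /
        (N + 1).factorial) * pointMoment ((i : ℕ) - θ t) p = (nodePoly N (θ t)).coeff p *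
          ((i : ℕ) - θ t) ^ p / (N + 1).factorial := fun p => by
        have : (p.factorial : ℝ) ≠ 0 := by exact_mod_cast p.factorial_ne_zero
        rw [pointMoment]
        field_simp
      have e2 := Polynomial.eval_eq_sum_range (p := nodePoly N (θ t)) ((i : ℕ) - θ t)
      rw [nodePoly_natDegree, nodePoly_eval _ _ (by omega)] at e2
      simp only [e1, ← Finset.sum_div, ← e2, zero_div]
    exact_mod_cast congrArg (fun r : ℝ => (r : 𝕜)) h0
  · have : ((N + 1).factorial : ℝ) ≠ 0 := by exact_mod_cast (N + 1).factorial_ne_zero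
    rw [nodePoly_coeff_top, mul_one, div_self this, RCLike.ofReal_one]

end

/-! ### Separation of functional and centre; uniform Taylor expansions -/

theorem sum_range_antidiagonal {M : Type*} [AddCommMonoid M] (K : ℕ) (f : ℕ × ℕ → M) :
    ∑ m ∈ Finset.range K, ∑ x ∈ Finset.HasAntidiagonal.antidiagonal m, f x = ∑ x ∈ lowPairs K, f x := by
  rw [← Finset.sum_fiberwise_of_maps_to (s := lowPairs K) (t := Finset.range K)
    (g := fun x => x.1 + x.2) fun x hx => Finset.mem_range.mpr (mem_lowPairs.mp hx)]
  refine Finset.sum_congr rfl fun m hm => Finset.sum_congr ?_ fun _ _ => rfl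
  ext x
  simp only [Finset.HasAntidiagonal.mem_antidiagonal, Finset.mem_filter, mem_lowPairs]
  have := Finset.mem_range.mp hm
  constructor
  · intro h; exact ⟨by omega, h⟩
  · exact fun h => h.2

theorem pointMoment_add (a b : ℝ) (m : ℕ) :
    pointMoment (a + b) m =
      ∑ x ∈ Finset.HasAntidiagonal.antidiagonal m, pointMoment a x.1 * pointMoment b x.2 := by
  rw [pointMoment, (Commute.all a b).add_pow', Finset.sum_div]
  refine Finset.sum_congr rfl fun x hx => ?_
  have hx' := Finset.HasAntidiagonal.mem_antidiagonal.mp hx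
  have h1 : (x.1.factorial : ℝ) ≠ 0 := by exact_mod_cast x.1.factorial_ne_zero
  have h2 : (x.2.factorial : ℝ) ≠ 0 := by exact_mod_cast x.2.factorial_ne_zero
  have h3 : (m.factorial : ℝ) ≠ 0 := by exact_mod_cast m.factorial_ne_zero
  have h4 : ((m.choose x.1 * x.1.factorial * x.2.factorial : ℕ) : ℝ) = (m.factorial : ℕ) := by
    have := Nat.choose_mul_factorial_mul_factorial (Nat.le_add_right x.1 x.2)
    rw [Nat.add_sub_cancel_left] at this
    rw [← hx', this]
  push_cast at h4
  simp only [pointMoment, nsmul_eq_mul]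
  rw [div_mul_div_comm, div_eq_div_iff h3 (mul_ne_zero h1 h2), ← h4]
  ring

/-- In the binomial expansion the terms of degree 0 in a and b cancel, which produces the index
shift and lets cell moments factor out. -/
theorem pointMoment_sub_pointMoment (a b c : ℝ) (m : ℕ) :
    pointMoment (b + c) (m + 1) - pointMoment (a + c) (m + 1) = ∑ x ∈ Finset.HasAntidiagonal.antidiagonal m,
      (pointMoment b (x.1 + 1) - pointMoment a (x.1 + 1)) * pointMoment c x.2 := by
  rw [pointMoment_add, pointMoment_add, Finset.Nat.sum_antidiagonal_succ,
    Finset.Nat.sum_antidiagonal_succ]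
  simp only [sub_mul, Finset.sum_sub_distrib]
  simp [pointMoment]

theorem cellMoment_eq (θ : ℝ) (i p : ℕ) :
    cellMoment θ i p = pointMoment (i + 1 - θ) (p + 1) - pointMoment (i - θ) (p + 1) := by
  rw [cellMoment, pointMoment, pointMoment, sub_div]

theorem eventually_differentiableAt_of_contDiffAt {𝕜 : Type*} [RCLike 𝕜] {f : 𝕜 → 𝕜} {a : 𝕜}
    (hf : ContDiffAt 𝕜 ∞ f a) : ∀ᶠ y in 𝓝 a, DifferentiableAt 𝕜 f y :=
  (hf.of_le (by simp : (1 : WithTop ℕ∞) ≤ ∞)).eventually (by simp) |>.mono fun _ hy =>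
    hy.differentiableAt (by simp)

section

variable {T 𝕜 : Type*} [RCLike 𝕜] {F : Filter T}

theorem eventually_forall_mul_mem {ε : T → 𝕜} (hε : Tendsto ε F (𝓝 0)) (B : ℝ) {p : 𝕜 → Prop}
    {a : 𝕜} (hp : ∀ᶠ z in 𝓝 a, p z) : ∀ᶠ t in F, ∀ s : ℝ, |s| ≤ B → p (a + ε t * s) := by
  obtain ⟨r, hr, hball⟩ := Metric.eventually_nhds_iff_ball.mp hp
  have h1 : Tendsto (fun t => ‖ε t‖ * (|B| + 1)) F (𝓝 0) := by
    simpa using hε.norm.mul_const (|B| + 1)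
  filter_upwards [h1.eventually_lt_const hr] with t ht s hs
  refine hball _ ?_
  rw [Metric.mem_ball, dist_eq_norm, add_sub_cancel_left, norm_mul, RCLike.norm_ofReal]
  refine lt_of_le_of_lt ?_ ht
  gcongr
  exact hs.trans ((le_abs_self B).trans (by linarith))

theorem isBigO_comp_sub_taylorSum {f : 𝕜 → 𝕜} {x : 𝕜} (hf : ContDiffAt 𝕜 ∞ f x) (K : ℕ)
    {ε : T → 𝕜} (hε : Tendsto ε F (𝓝 0)) (B : ℝ) :
    ∃ C : ℝ, ∀ᶠ t in F, ∀ s : ℝ, |s| ≤ B →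
      ‖f (x + ε t * s) - ∑ p ∈ Finset.range K,
        (ε t ^ p * iteratedDeriv p f x) * (s : 𝕜) ^ p / (p.factorial : 𝕜)‖ ≤ C * ‖ε t ^ K‖ := by
  obtain ⟨C, hC⟩ := (isBigO_sub_taylorSum K hf).bound
  refine ⟨|C| * |B| ^ K, ?_⟩
  filter_upwards [eventually_forall_mul_mem hε B hC] with t ht s hs
  have h1 := ht s hs
  rw [zero_add] at h1
  have h2 : ∀ p, (ε t ^ p * iteratedDeriv p f x) * (s : 𝕜) ^ p / (p.factorial : 𝕜) =
      iteratedDeriv p f x * (ε t * s) ^ p / (p.factorial : 𝕜) := fun p => by rw [mul_pow]; ring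
  simp only [h2]
  refine h1.trans ?_
  rw [mul_pow, norm_mul, norm_pow (s : 𝕜), RCLike.norm_ofReal]
  calc C * (‖ε t ^ K‖ * |s| ^ K) ≤ |C| * (‖ε t ^ K‖ * |B| ^ K) := by
        have h3 : |s| ^ K ≤ |B| ^ K :=
          pow_le_pow_left₀ (abs_nonneg s) (hs.trans (le_abs_self B)) K
        have h4 := le_abs_self C
        gcongr
    _ = _ := by ring

theorem integral_comp_sub_taylorSum_isBigO {f : 𝕜 → 𝕜} {x : 𝕜} (hf : ContDiffAt 𝕜 ∞ f x) (K : ℕ)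
    {ε : T → 𝕜} (hε : Tendsto ε F (𝓝 0)) {a b : T → ℝ} {B : ℝ} (ha : ∀ᶠ t in F, |a t| ≤ B)
    (hb : ∀ᶠ t in F, |b t| ≤ B) :
    (fun t => (∫ s in (a t)..(b t), f (x + ε t * (s : 𝕜))) - ∑ p ∈ Finset.range K,
      (ε t ^ p * iteratedDeriv p f x) *
        ((pointMoment (b t) (p + 1) - pointMoment (a t) (p + 1) : ℝ) : 𝕜))
      =O[F] fun t => ε t ^ K := by
  obtain ⟨C, hC⟩ := isBigO_comp_sub_taylorSum hf K hε B
  refine IsBigO.of_bound (|C| * (2 * |B|)) ?_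
  filter_upwards [hC, ha, hb, eventually_forall_mul_mem hε B
    (eventually_differentiableAt_of_contDiffAt hf)] with t ht hat hbt hdt
  have hmem : ∀ s ∈ Set.uIcc (a t) (b t), |s| ≤ B := fun s hs => by
    have h1 := abs_le.mp hat
    have h2 := abs_le.mp hbt
    rcases Set.mem_uIcc.mp hs with h | h <;> exact abs_le.mpr ⟨by linarith, by linarith⟩
  have hcont : ContinuousOn (fun s : ℝ => f (x + ε t * (s : 𝕜))) (Set.uIcc (a t) (b t)) :=
    fun s hs => by
      have h1 : ContinuousAt (fun s : ℝ => x + ε t * (s : 𝕜)) s := by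
        have := RCLike.continuous_ofReal (K := 𝕜)
        fun_prop
      exact (ContinuousAt.comp (f := fun s : ℝ => x + ε t * (s : 𝕜)) (g := f)
        (hdt s (hmem s hs)).continuousAt h1).continuousWithinAt
  have h1 := norm_integral_sub_taylorSum_le hcont fun s hs => ht s (hmem s hs)
  simp only [pointMoment, ← sub_div]
  refine h1.trans ?_
  have h3 : |b t - a t| ≤ 2 * |B| := by
    have := abs_sub (b t) (a t)
    have := le_abs_self B
    linarith
  calc C * ‖ε t ^ K‖ * |b t - a t| ≤ |C| * ‖ε t ^ K‖ * (2 * |B|) := by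
        gcongr
        exact le_abs_self C
    _ = _ := by ring

theorem isBigO_ofReal {f g : T → ℝ} (h : f =O[F] g) :
    (fun t => (f t : 𝕜)) =O[F] fun t => (g t : 𝕜) := by
  rw [← isBigO_norm_norm]
  simpa [RCLike.norm_ofReal] using h.norm_norm

end

/-! ### Direct reconstruction from cell averages -/

section

variable {𝕜 : Type} [RCLike 𝕜]

/-- The defining system transposed, by symmetry of the Hankel matrix; the weights are row vectors.
-/
theorem errorCoeff_sum {φ : 𝕜 → 𝕜} {n : ℕ} (hdet : (derivMatrix φ n).det ≠ 0) (q : Fin n) :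
    ∑ p : Fin n, errorCoeff φ n p * iteratedDeriv ((p : ℕ) + q) φ 0 =
      iteratedDeriv (n + q) φ 0 := by
  have h : Matrix.mulVec (derivMatrix φ n) (errorCoeff φ n) =
      fun i : Fin n => iteratedDeriv ((i : ℕ) + n) φ 0 := by
    rw [errorCoeff, Matrix.mulVec_mulVec, Matrix.mul_nonsing_inv _ (isUnit_iff_ne_zero.mpr hdet),
      Matrix.one_mulVec]
  have h2 := congrFun h q
  simp only [Matrix.mulVec, dotProduct, derivMatrix, Matrix.of_apply] at h2
  rw [add_comm n, ← h2]
  exact Finset.sum_congr rfl fun p _ => by rw [add_comm (p : ℕ), mul_comm]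

theorem cellAverage_eq_integral (f : ℝ → 𝕜) (x θ : ℝ) {h : ℝ} (hh : h ≠ 0) (i : ℕ) :
    cellAverage f (x - θ * h) h i = ∫ s in (i - θ)..(i + 1 - θ), f (x + h * s) := by
  rw [intervalIntegral.integral_comp_add_mul _ hh, cellAverage, RCLike.real_smul_eq_coe_mul,
    RCLike.ofReal_inv]
  congr 2 <;> simp only [face] <;> push_cast <;> ring

/-- The matrix of the linear system for the coefficients of the direct reconstruction. -/
noncomputable def averageMatrix (N : ℕ) (B : ℝ → 𝕜) (a h : ℝ) : Matrix (Fin N) (Fin N) 𝕜 :=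
  Matrix.of fun i k => cellAverage (fun y => B (y - center a h k)) a h i

/-- Duality: with α = A⁻¹ v and w A = b, the value at x is b · α = w · A α = w · v. -/
theorem directWithin_of_weights {N : ℕ} {B : ℝ → 𝕜} {u : ℝ → ℝ} {a h x : ℝ} {W : 𝕜} {ε : ℝ}
    (hint : ∀ i k : Fin N, IntervalIntegrable (fun y => B (y - center a h k)) MeasureTheory.volume
      (face a h i) (face a h (i + 1)))
    (hdet : (averageMatrix N B a h).det ≠ 0) {w : Fin N → 𝕜}
    (hw : Matrix.vecMul w (averageMatrix N B a h) = fun k : Fin N => B (x - center a h k))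
    (hε : ‖w ⬝ᵥ (fun i => ((cellAverage u a h i : ℝ) : 𝕜)) - W‖ ≤ ε) :
    DirectWithin N B u a h x W ε := by
  set v : Fin N → 𝕜 := fun i => ((cellAverage u a h i : ℝ) : 𝕜) with hv
  have hfit : ∀ β : Fin N → 𝕜, FitsAverages B a h (fun i : Fin N => cellAverage u a h i) β ↔
      Matrix.mulVec (averageMatrix N B a h) β = v := fun β => by
    have h1 : ∀ i : Fin N, cellAverage (rbfSum B (center a h) β) a h i =
        Matrix.mulVec (averageMatrix N B a h) β i := fun i => by
      simp only [cellAverage, rbfSum, Matrix.mulVec, dotProduct, averageMatrix, Matrix.of_apply]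
      rw [intervalIntegral.integral_finsetSum fun k _ => (hint i k).const_mul _, Finset.mul_sum]
      refine Finset.sum_congr rfl fun k _ => ?_
      rw [intervalIntegral.integral_const_mul]
      ring
    simp only [FitsAverages, h1, funext_iff, hv]
  have hu := isUnit_iff_ne_zero.mpr hdet
  have hsol : Matrix.mulVec (averageMatrix N B a h)
      (Matrix.mulVec (averageMatrix N B a h)⁻¹ v) = v := by
    rw [Matrix.mulVec_mulVec, Matrix.mul_nonsing_inv _ hu, Matrix.one_mulVec]
  refine ⟨Matrix.mulVec (averageMatrix N B a h)⁻¹ v, (hfit _).mpr hsol, fun β hβ => ?_, ?_⟩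
  · rw [← (hfit β).mp hβ, Matrix.mulVec_mulVec, Matrix.nonsing_inv_mul _ hu, Matrix.one_mulVec]
  · have h1 : rbfSum B (center a h) (Matrix.mulVec (averageMatrix N B a h)⁻¹ v) x = w ⬝ᵥ v := by
      calc rbfSum B (center a h) (Matrix.mulVec (averageMatrix N B a h)⁻¹ v) x
          = (fun k : Fin N => B (x - center a h k)) ⬝ᵥ
              Matrix.mulVec (averageMatrix N B a h)⁻¹ v := by
            simp only [rbfSum, dotProduct, mul_comm]
        _ = w ⬝ᵥ v := by rw [← hw, ← Matrix.dotProduct_mulVec, hsol]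
    rwa [h1]

theorem averageMatrix_shaped_apply {N : ℕ} (φ : 𝕜 → 𝕜) (l : 𝕜) (x θ : ℝ) {h : ℝ} (hh : h ≠ 0)
    (i k : Fin N) :
    averageMatrix N (shaped φ l) (x - θ * h) h i k =
      ∫ s in (((i : ℕ) : ℝ) - θ + (θ - (k + 1 / 2)))..(((i : ℕ) : ℝ) + 1 - θ + (θ - (k + 1 / 2))),
        φ (0 + l * h * (s : 𝕜)) := by
  rw [← intervalIntegral.integral_comp_add_right (fun s : ℝ => φ (0 + l * h * (s : 𝕜)))]
  simp only [averageMatrix, Matrix.of_apply]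
  rw [cellAverage_eq_integral _ _ _ hh]
  refine intervalIntegral.integral_congr fun s _ => ?_
  simp only [shaped, center, zero_add]
  congr 1
  push_cast
  ring

theorem abs_sub_le_of_mem_Icc {N : ℕ} {θ : ℝ} (hθ : θ ∈ Set.Icc (0 : ℝ) N) {y : ℝ} (hy0 : 0 ≤ y)
    (hy : y ≤ N) : |y - θ| ≤ N :=
  abs_le.mpr ⟨by linarith [hθ.2], by linarith [hθ.1]⟩

variable {T : Type*} {F : Filter T}

theorem eventually_intervalIntegrable_shaped {φ : 𝕜 → 𝕜} (hφ : ContDiffAt 𝕜 ∞ φ 0) (N : ℕ)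
    {h : T → ℝ} {l : T → 𝕜} (hh : ∀ᶠ t in F, 0 < h t)
    (hε : Tendsto (fun t => l t * (h t : 𝕜)) F (𝓝 0)) (a : T → ℝ) :
    ∀ᶠ t in F, ∀ i k : Fin N, IntervalIntegrable
      (fun y => shaped φ (l t) (y - center (a t) (h t) k)) MeasureTheory.volume
      (face (a t) (h t) i) (face (a t) (h t) (i + 1)) := by
  filter_upwards [eventually_forall_mul_mem hε N (eventually_differentiableAt_of_contDiffAt hφ), hh]
    with t ht hht i k
  refine ContinuousOn.intervalIntegrable fun y hy => ?_
  have hle : face (a t) (h t) i ≤ face (a t) (h t) (i + 1) := by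
    simp only [face]; push_cast; nlinarith
  rw [Set.uIcc_of_le hle] at hy
  have hi : ((i : ℕ) : ℝ) + 1 ≤ N := by exact_mod_cast i.2
  have hk : ((k : ℕ) : ℝ) + 1 ≤ N := by exact_mod_cast k.2
  have hi0 : (0 : ℝ) ≤ (i : ℕ) := Nat.cast_nonneg _
  have hk0 : (0 : ℝ) ≤ (k : ℕ) := Nat.cast_nonneg _
  have hs : |(y - center (a t) (h t) k) / h t| ≤ N := by
    rw [abs_div, abs_of_pos hht, div_le_iff₀ hht, abs_le]
    simp only [face, center] at hy ⊢
    push_cast at hy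
    constructor <;> nlinarith [hy.1, hy.2]
  have h1 := (ht _ hs).continuousAt
  have h2 : (0 : 𝕜) + l t * (h t : 𝕜) * (((y - center (a t) (h t) k) / h t : ℝ) : 𝕜) =
      l t * ((y - center (a t) (h t) k : ℝ) : 𝕜) := by
    have : (h t : 𝕜) ≠ 0 := by exact_mod_cast hht.ne'
    push_cast
    field_simp
    ring
  rw [h2] at h1
  have h3 : ContinuousAt (fun y : ℝ => l t * ((y - center (a t) (h t) k : ℝ) : 𝕜)) y := by
    have := RCLike.continuous_ofReal (K := 𝕜)
    fun_prop
  exact (ContinuousAt.comp (f := fun y : ℝ => l t * ((y - center (a t) (h t) k : ℝ) : 𝕜)) (g := φ)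
    h1 h3).continuousWithinAt

/-- The leading error term of the direct reconstruction. -/
theorem eventually_directWithin {φ : 𝕜 → 𝕜} (hφ : ContDiffAt 𝕜 ∞ φ 0) {N : ℕ}
    (hdet : (derivMatrix φ N).det ≠ 0) {u : ℝ → ℝ} {x : ℝ} (hu : ContDiffAt ℝ ∞ u x)
    {h θ : T → ℝ} {l : T → 𝕜} (hh : Tendsto h F (𝓝[>] 0))
    (hl : l =O[F] fun _ => (1 : 𝕜)) (hl0 : ∀ᶠ t in F, l t ≠ 0)
    (hθ : ∀ᶠ t in F, θ t ∈ Set.Icc (0 : ℝ) N) :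
    ∃ C : ℝ, ∀ᶠ t in F, DirectWithin N (shaped φ (l t)) u (x - θ t * h t) (h t) x
      ((u x : 𝕜) + (positionFactor N (θ t) * h t ^ N : ℝ) * directSymbol N φ u x (l t))
      (C * h t ^ (N + 1)) := by
  have hh0 : ∀ᶠ t in F, 0 < h t := hh.eventually self_mem_nhdsWithin
  have hhR : Tendsto h F (𝓝 0) := hh.mono_right nhdsWithin_le_nhds
  have hη : Tendsto (fun t => (h t : 𝕜)) F (𝓝 0) :=
    ((RCLike.continuous_ofReal (K := 𝕜)).tendsto' 0 0 RCLike.ofReal_zero).comp hhR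
  have hε : Tendsto (fun t => l t * (h t : 𝕜)) F (𝓝 0) :=
    (isBigO_one_mul hl (isBigO_refl (fun t => (h t : 𝕜)) F)).trans_tendsto hη
  have hbnd : ∀ i : Fin N, (∀ᶠ t in F, |((i : ℕ) : ℝ) - θ t| ≤ N) ∧
      (∀ᶠ t in F, |((i : ℕ) : ℝ) + 1 - θ t| ≤ N) := fun i => by
    have hi : ((i : ℕ) : ℝ) + 1 ≤ N := by exact_mod_cast i.2
    have hi0 : (0 : ℝ) ≤ (i : ℕ) := Nat.cast_nonneg _
    exact ⟨hθ.mono fun t ht => abs_sub_le_of_mem_Icc ht hi0 (by linarith),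
      hθ.mono fun t ht => abs_sub_le_of_mem_Icc ht (by linarith) hi⟩
  refine Exists.elim (exists_weights_isBigO (F := F) (n := N) (fun m => iteratedDeriv m φ 0) hdet
    (c := errorCoeff φ N) (errorCoeff_sum hdet) (l := l) (η := fun t => (h t : 𝕜)) hη
    (hh0.mono fun t ht => by exact_mod_cast ht.ne') hl hl0
    (boundedUnisolvent_cellMoment 𝕜 N hθ)
    (boundedUnisolvent_pointMoment 𝕜 (Y := fun θ (k : Fin N) => θ - ((k : ℕ) + 1 / 2))
      (fun i => by fun_prop) (fun θ i j h => by simpa [Fin.ext_iff] using h) hθ)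
    (fun p => if p = 0 then 1 else 0)
    (A := fun t => averageMatrix N (shaped φ (l t)) (x - θ t * h t) (h t))
    (b := fun t k => shaped φ (l t) (x - center (x - θ t * h t) (h t) k))
    (v := fun t i => ((cellAverage u (x - θ t * h t) (h t) i : ℝ) : 𝕜))
    (f := fun _ p => ((iteratedDeriv p u x : ℝ) : 𝕜))
    (fun p => isBigO_const_const _ one_ne_zero _) ?_ ?_ ?_) ?_
  · intro i k
    have hk : ((k : ℕ) : ℝ) + 1 ≤ N := by exact_mod_cast k.2
    have hk0 : (0 : ℝ) ≤ (k : ℕ) := Nat.cast_nonneg _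
    have hc : ∀ᶠ t in F, |θ t - ((k : ℕ) + 1 / 2)| ≤ N := hθ.mono fun t ht => by
      rw [abs_sub_comm]
      exact abs_sub_le_of_mem_Icc ht (by linarith) (by linarith)
    have h1 := integral_comp_sub_taylorSum_isBigO hφ (2 * N) hε (B := 2 * N)
      (a := fun t => ((i : ℕ) : ℝ) - θ t + (θ t - ((k : ℕ) + 1 / 2)))
      (b := fun t => ((i : ℕ) : ℝ) + 1 - θ t + (θ t - ((k : ℕ) + 1 / 2)))
      (by filter_upwards [(hbnd i).1, hc] with t h1 h2
          exact (abs_add_le _ _).trans (by linarith))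
      (by filter_upwards [(hbnd i).2, hc] with t h1 h2
          exact (abs_add_le _ _).trans (by linarith))
    refine h1.congr' ?_ EventuallyEq.rfl
    filter_upwards [hh0] with t ht
    rw [averageMatrix_shaped_apply φ (l t) x (θ t) ht.ne' i k]
    congr 1
    rw [← sum_range_antidiagonal]
    refine Finset.sum_congr rfl fun m _ => ?_
    rw [pointMoment_sub_pointMoment]
    push_cast
    rw [Finset.mul_sum]
    refine Finset.sum_congr rfl fun y hy => ?_
    rw [Finset.HasAntidiagonal.mem_antidiagonal.mp hy, cellMoment_eq]
    push_cast
    ring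
  · intro k
    have hk : ((k : ℕ) : ℝ) + 1 ≤ N := by exact_mod_cast k.2
    have hk0 : (0 : ℝ) ≤ (k : ℕ) := Nat.cast_nonneg _
    obtain ⟨C, hC⟩ := isBigO_comp_sub_taylorSum hφ (2 * N) hε (N : ℝ)
    refine IsBigO.of_bound C ?_
    filter_upwards [hC, hθ] with t h1 ht
    have h2 := h1 (θ t - ((k : ℕ) + 1 / 2)) (by
      rw [abs_sub_comm]; exact abs_sub_le_of_mem_Icc ht (by linarith) (by linarith))
    convert h2 using 3
    · simp only [shaped, center, zero_add]
      congr 1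
      push_cast
      ring
    · rw [← sum_range_antidiagonal]
      refine Finset.sum_congr rfl fun m _ => ?_
      -- The target is evaluation at the origin s = 0, which sees only p = 0.
      rw [Finset.sum_eq_single (0, m)]
      · simp [pointMoment]; ring
      · rintro ⟨p, q⟩ hpq hne
        have : p ≠ 0 := fun hp => hne (by subst hp; simpa using hpq)
        simp [this]
      · intro h; simp at h
  · intro i
    have h1 := isBigO_ofReal (𝕜 := 𝕜) (integral_comp_sub_taylorSum_isBigO (𝕜 := ℝ) hu (N + 1) hhR
      (hbnd i).1 (hbnd i).2)
    refine h1.congr' ?_ (Eventually.of_forall fun t => by simp)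
    filter_upwards [hh0] with t ht
    rw [cellAverage_eq_integral _ _ _ ht.ne']
    simp only [cellMoment_eq]
    push_cast
    simp
  · rintro w ⟨hw, hO⟩
    obtain ⟨C, hC⟩ := hO.bound
    refine ⟨C, ?_⟩
    filter_upwards [hw, hC, hh0, eventually_intervalIntegrable_shaped hφ N hh0 hε
      (fun t => x - θ t * h t), momentError_cellMoment (𝕜 := 𝕜) (N := N) hθ] with t h1 h2 h3 h4 h5
    refine directWithin_of_weights h4 h1.1 h1.2 ?_
    rw [h5] at h2
    rw [norm_pow, RCLike.norm_ofReal, abs_of_pos h3] at h2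
    convert h2 using 3
    rw [Finset.sum_eq_single 0 (fun p _ hp => by simp [hp]) (fun h => absurd (by simp) h)]
    simp only [directSymbol, if_true, pow_zero, one_mul, iteratedDeriv_zero]
    push_cast
    ring

end

/-! ### Reconstruction through a primitive function -/

theorem sum_ite_lt_eq_sum_range {N : ℕ} (g : ℕ → ℝ) {k : ℕ} (hk : k ≤ N) :
    (∑ i : Fin N, if (i : ℕ) < k then g i else 0) = ∑ i ∈ Finset.range k, g i := by
  rw [Fin.sum_univ_eq_sum_range (fun i => if i < k then g i else 0), ← Finset.sum_filter]
  refine Finset.sum_congr ?_ fun _ _ => rfl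
  ext i
  simp only [Finset.mem_filter, Finset.mem_range]
  omega

theorem primitiveData_eq_integral {N : ℕ} {u : ℝ → ℝ} {x θ h : ℝ} (hh : h ≠ 0)
    (hθ : θ ∈ Set.Icc (0 : ℝ) N) (hc : ∀ s : ℝ, |s| ≤ N → ContinuousAt u (x + h * s))
    (b k : Fin (N + 1)) :
    primitiveData h (fun i : Fin N => cellAverage u (x - θ * h) h i) b k =
      h * ∫ s in (((b : ℕ) : ℝ) - θ)..(((k : ℕ) : ℝ) - θ), u (x + h * s) := by
  have hcont : ∀ i j : ℕ, i ≤ N → j ≤ N → IntervalIntegrable (fun s => u (x + h * s))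
      MeasureTheory.volume ((i : ℝ) - θ) ((j : ℝ) - θ) := fun i j hi hj => by
    refine ContinuousOn.intervalIntegrable fun s hs => ?_
    have hi' : (i : ℝ) ≤ N := by exact_mod_cast hi
    have hj' : (j : ℝ) ≤ N := by exact_mod_cast hj
    have hi0 : (0 : ℝ) ≤ i := Nat.cast_nonneg _
    have hj0 : (0 : ℝ) ≤ j := Nat.cast_nonneg _
    have hs' : |s| ≤ N := by
      rw [abs_le]
      rcases Set.mem_uIcc.mp hs with h | h <;> constructor <;> linarith [hθ.1, hθ.2, h.1, h.2]
    exact (ContinuousAt.comp (f := fun s : ℝ => x + h * s) (g := u) (hc s hs')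
      (by fun_prop)).continuousWithinAt
  have hsum : ∀ k : Fin (N + 1), (∑ i : Fin N, if (i : ℕ) < k then
      cellAverage u (x - θ * h) h i else 0) =
      ∫ s in (((0 : ℕ) : ℝ) - θ)..(((k : ℕ) : ℝ) - θ), u (x + h * s) := fun k => by
    rw [sum_ite_lt_eq_sum_range (fun i => cellAverage u (x - θ * h) h i) (Nat.lt_succ_iff.mp k.2),
      ← intervalIntegral.sum_integral_adjacent_intervals (a := fun i : ℕ => (i : ℝ) - θ)
        (n := (k : ℕ)) fun i hi => hcont i (i + 1) (by omega) (by omega)]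
    refine Finset.sum_congr rfl fun i _ => ?_
    rw [cellAverage_eq_integral _ _ _ hh]
    push_cast
    simp
  rw [primitiveData, hsum, hsum, intervalIntegral.integral_interval_sub_left
    (hcont _ _ (by omega) (by omega)) (hcont _ _ (by omega) (by omega))]

section

variable {𝕜 : Type} [RCLike 𝕜]

/-- The matrix of the linear system for the interpolant of the primitive function. -/
noncomputable def faceMatrix (N : ℕ) (B : ℝ → 𝕜) (a h : ℝ) :
    Matrix (Fin (N + 1)) (Fin (N + 1)) 𝕜 :=
  Matrix.of fun i k => B (face a h i - face a h k)

/-- The same duality, for h AU'(x): the factor h makes the target the derivative in the rescaled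
coordinate. -/
theorem primitiveWithin_of_weights {N : ℕ} {B : ℝ → 𝕜} {u : ℝ → ℝ} {a h x : ℝ} {b : Fin (N + 1)}
    {W : 𝕜} {ε : ℝ} (hh : 0 < h) (hdet : (faceMatrix N B a h).det ≠ 0) {w : Fin (N + 1) → 𝕜}
    (hw : Matrix.vecMul w (faceMatrix N B a h) =
      fun k : Fin (N + 1) => (h : 𝕜) * deriv B (x - face a h k))
    (hε : ‖w ⬝ᵥ (fun k => ((primitiveData h (fun i : Fin N => cellAverage u a h i) b k : ℝ) : 𝕜)) -
      h * W‖ ≤ h * ε) :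
    PrimitiveWithin N B u a h b x W ε := by
  set v : Fin (N + 1) → 𝕜 :=
    fun k => ((primitiveData h (fun i : Fin N => cellAverage u a h i) b k : ℝ) : 𝕜) with hv
  have hfit : ∀ β : Fin (N + 1) → 𝕜,
      FitsPrimitive B a h b (fun i : Fin N => cellAverage u a h i) β ↔
      Matrix.mulVec (faceMatrix N B a h) β = v := fun β => by
    have h1 : ∀ i : Fin (N + 1), rbfSum B (face a h) β (face a h i) =
        Matrix.mulVec (faceMatrix N B a h) β i := fun i => by
      simp only [rbfSum, Matrix.mulVec, dotProduct, faceMatrix, Matrix.of_apply, mul_comm]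
    simp only [FitsPrimitive, h1, funext_iff, hv]
  have hu := isUnit_iff_ne_zero.mpr hdet
  have hsol : Matrix.mulVec (faceMatrix N B a h)
      (Matrix.mulVec (faceMatrix N B a h)⁻¹ v) = v := by
    rw [Matrix.mulVec_mulVec, Matrix.mul_nonsing_inv _ hu, Matrix.one_mulVec]
  refine ⟨Matrix.mulVec (faceMatrix N B a h)⁻¹ v, (hfit _).mpr hsol, fun β hβ => ?_, ?_⟩
  · rw [← (hfit β).mp hβ, Matrix.mulVec_mulVec, Matrix.nonsing_inv_mul _ hu, Matrix.one_mulVec]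
  · have h1 : h * rbfSum (deriv B) (face a h) (Matrix.mulVec (faceMatrix N B a h)⁻¹ v) x =
        w ⬝ᵥ v := by
      calc h * rbfSum (deriv B) (face a h) (Matrix.mulVec (faceMatrix N B a h)⁻¹ v) x
          = (fun k : Fin (N + 1) => (h : 𝕜) * deriv B (x - face a h k)) ⬝ᵥ
              Matrix.mulVec (faceMatrix N B a h)⁻¹ v := by
            simp only [rbfSum, dotProduct, Finset.mul_sum]
            exact Finset.sum_congr rfl fun k _ => by ring
        _ = w ⬝ᵥ v := by rw [← hw, ← Matrix.dotProduct_mulVec, hsol]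
    rw [← h1, ← mul_sub, norm_mul, RCLike.norm_ofReal, abs_of_pos hh] at hε
    exact le_of_mul_le_mul_left hε hh

theorem deriv_shaped {φ : 𝕜 → 𝕜} {l : 𝕜} {y : ℝ} (hφ : DifferentiableAt 𝕜 φ (l * (y : 𝕜))) :
    deriv (shaped φ l) y = l * deriv φ (l * (y : 𝕜)) := by
  have h1 : HasDerivAt (fun y : ℝ => l * (y : 𝕜)) l y := by
    simpa using (RCLike.ofRealCLM (K := 𝕜)).hasDerivAt (x := y) |>.const_mul l
  have h2 : HasDerivAt (shaped φ l) _ y := hφ.hasDerivAt.scomp y h1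
  rw [h2.deriv, smul_eq_mul]

variable {T : Type*} {F : Filter T}

/-- The leading error term of the reconstruction through a primitive function. -/
theorem eventually_primitiveWithin {φ : 𝕜 → 𝕜} (hφ : ContDiffAt 𝕜 ∞ φ 0) {N : ℕ}
    (hdet : (derivMatrix φ (N + 1)).det ≠ 0) {u : ℝ → ℝ} {x : ℝ} (hu : ContDiffAt ℝ ∞ u x)
    {h θ : T → ℝ} {l : T → 𝕜} {b : T → Fin (N + 1)} (hh : Tendsto h F (𝓝[>] 0))
    (hl : l =O[F] fun _ => (1 : 𝕜)) (hl0 : ∀ᶠ t in F, l t ≠ 0)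
    (hθ : ∀ᶠ t in F, θ t ∈ Set.Icc (0 : ℝ) N) :
    ∃ C : ℝ, ∀ᶠ t in F, PrimitiveWithin N (shaped φ (l t)) u (x - θ t * h t) (h t) (b t) x
      ((u x : 𝕜) + (positionFactor N (θ t) * h t ^ N : ℝ) * primitiveSymbol N φ u x (l t))
      (C * h t ^ (N + 1)) := by
  have hh0 : ∀ᶠ t in F, 0 < h t := hh.eventually self_mem_nhdsWithin
  have hhR : Tendsto h F (𝓝 0) := hh.mono_right nhdsWithin_le_nhds
  have hη : Tendsto (fun t => (h t : 𝕜)) F (𝓝 0) :=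
    ((RCLike.continuous_ofReal (K := 𝕜)).tendsto' 0 0 RCLike.ofReal_zero).comp hhR
  have hη1 := hη.isBigO_one 𝕜
  have hε : Tendsto (fun t => l t * (h t : 𝕜)) F (𝓝 0) :=
    (isBigO_one_mul hl (isBigO_refl (fun t => (h t : 𝕜)) F)).trans_tendsto hη
  have hbnd : ∀ᶠ t in F, ∀ i : Fin (N + 1), |((i : ℕ) : ℝ) - θ t| ≤ N := by
    filter_upwards [hθ] with t ht i
    exact abs_sub_le_of_mem_Icc ht (Nat.cast_nonneg _)
      (by exact_mod_cast Nat.lt_succ_iff.mp i.2)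
  have hbnd' : ∀ᶠ t in F, ∀ i : Fin (N + 1), |θ t - ((i : ℕ) : ℝ)| ≤ N := by
    filter_upwards [hbnd] with t ht i
    rw [abs_sub_comm]
    exact ht i
  have hμ := boundedUnisolvent_pointMoment 𝕜 (F := F)
    (Y := fun θ (i : Fin (N + 1)) => ((i : ℕ) : ℝ) - θ)
    (fun i => by fun_prop) (fun θ i j h => by simpa [Fin.ext_iff] using h) hθ
  -- h f₀ is the truncated Taylor expansion of U(x), the integral of u from interface `b` to x; f₀
  -- stays bounded.
  set f₀ : T → ℝ := fun t => -∑ p ∈ Finset.range (N + 1),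
    h t ^ p * iteratedDeriv p u x * pointMoment (((b t : ℕ) : ℝ) - θ t) (p + 1) with hf₀
  have hf₀O : (fun t => (f₀ t : 𝕜)) =O[F] fun _ => (1 : 𝕜) := by
    have h1 : f₀ =O[F] fun _ => (1 : ℝ) := by
      refine (IsBigO.fun_sum fun p _ => ?_).neg_left
      refine isBigO_one_mul (isBigO_mul_one ?_ (isBigO_const_const _ one_ne_zero _)) ?_
      · simpa using (hhR.isBigO_one ℝ).pow p
      · refine IsBigO.of_bound ((N : ℝ) ^ (p + 1) / (p + 1).factorial) ?_
        filter_upwards [hbnd] with t ht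
        rw [pointMoment, norm_div, norm_pow, Real.norm_eq_abs, norm_one, mul_one,
          Real.norm_of_nonneg (Nat.cast_nonneg _)]
        gcongr
        exact ht _
    simpa using isBigO_ofReal (𝕜 := 𝕜) h1
  set f : T → ℕ → 𝕜 := fun t p => match p with
    | 0 => (h t : 𝕜) * (f₀ t : 𝕜)
    | p + 1 => ((iteratedDeriv p u x : ℝ) : 𝕜) with hf
  refine Exists.elim (exists_weights_isBigO (F := F) (n := N + 1)
    (fun m => iteratedDeriv m φ 0) hdet
    (c := errorCoeff φ (N + 1)) (errorCoeff_sum hdet) (l := l) (η := fun t => (h t : 𝕜)) hη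
    (hh0.mono fun t ht => by exact_mod_cast ht.ne') hl hl0 hμ
    (boundedUnisolvent_pointMoment 𝕜 (Y := fun θ (k : Fin (N + 1)) => θ - ((k : ℕ) : ℝ))
      (fun i => by fun_prop) (fun θ i j h => by simpa [Fin.ext_iff] using h) hθ)
    (fun p => if p = 1 then 1 else 0)
    (A := fun t => faceMatrix N (shaped φ (l t)) (x - θ t * h t) (h t))
    (b := fun t k => (h t : 𝕜) * deriv (shaped φ (l t)) (x - face (x - θ t * h t) (h t) k))
    (v := fun t k => ((primitiveData (h t) (fun i : Fin N => cellAverage u (x - θ t * h t) (h t) i)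
      (b t) k : ℝ) : 𝕜))
    (f := f) ?_ ?_ ?_ ?_) ?_
  · intro p
    cases p with
    | zero => exact isBigO_one_mul hη1 hf₀O
    | succ p => exact isBigO_const_const _ one_ne_zero _
  · intro i k
    obtain ⟨C, hC⟩ := isBigO_comp_sub_taylorSum hφ (2 * (N + 1)) hε ((N : ℝ) + N)
    refine IsBigO.of_bound C ?_
    filter_upwards [hC, hbnd, hbnd'] with t h1 h2 h3
    have h4 := h1 (((i : ℕ) - θ t) + (θ t - (k : ℕ)))
      ((abs_add_le _ _).trans (add_le_add (h2 i) (h3 k)))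
    convert h4 using 3
    · simp only [faceMatrix, Matrix.of_apply, shaped, face, zero_add]
      congr 1
      push_cast
      ring
    · rw [← sum_range_antidiagonal]
      refine Finset.sum_congr rfl fun m _ => ?_
      have h5 : (((i : ℕ) - θ t + (θ t - (k : ℕ)) : ℝ) : 𝕜) ^ m / (m.factorial : 𝕜) =
          ((pointMoment ((i : ℕ) - θ t + (θ t - (k : ℕ))) m : ℝ) : 𝕜) := by
        rw [pointMoment]; push_cast; rfl
      rw [mul_div_assoc, h5, pointMoment_add, RCLike.ofReal_sum, Finset.mul_sum]
      refine Finset.sum_congr rfl fun y hy => ?_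
      rw [Finset.HasAntidiagonal.mem_antidiagonal.mp hy]
      push_cast
      ring
  · intro k
    -- The target h d/dy brings down one factor ε, so expanding φ' to order 2N + 1 yields the
    -- required order 2(N + 1).
    obtain ⟨C, hC⟩ := isBigO_comp_sub_taylorSum (contDiffAt_deriv_infty hφ) (2 * N + 1) hε (N : ℝ)
    refine IsBigO.of_bound C ?_
    filter_upwards [hC, hbnd', eventually_forall_mul_mem hε N
      (eventually_differentiableAt_of_contDiffAt hφ)] with t h1 h2 h3
    have h4 := mul_le_mul_of_nonneg_left (h1 _ (h2 k)) (norm_nonneg (l t * (h t : 𝕜)))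
    rw [← norm_mul] at h4
    refine le_of_eq_of_le (congrArg norm ?_) (h4.trans_eq (by
      rw [mul_left_comm, ← norm_mul, ← pow_succ']; rfl))
    have hy : l t * ((x - face (x - θ t * h t) (h t) k : ℝ) : 𝕜) =
        0 + l t * (h t : 𝕜) * ((θ t - (k : ℕ) : ℝ) : 𝕜) := by
      simp only [face]; push_cast; ring
    rw [deriv_shaped (hy ▸ h3 _ (h2 k)), hy, mul_sub]
    congr 1
    · ring
    · rw [← sum_range_antidiagonal, show 2 * (N + 1) = 2 * N + 1 + 1 by ring,
        Finset.sum_range_succ', Finset.mul_sum]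
      have h5 : ∑ y ∈ Finset.HasAntidiagonal.antidiagonal 0, iteratedDeriv (y.1 + y.2) φ 0 *
          (l t * (h t : 𝕜)) ^ (y.1 + y.2) * ((if y.1 = 1 then (1 : 𝕜) else 0) *
          ((pointMoment (θ t - (k : ℕ)) y.2 : ℝ) : 𝕜)) = 0 := by simp
      rw [h5, add_zero]
      refine Finset.sum_congr rfl fun m _ => ?_
      rw [Finset.sum_eq_single (1, m)]
      · simp only [if_true, one_mul, pointMoment, iteratedDeriv_succ', add_comm 1 m]
        push_cast
        ring
      · rintro ⟨p, q⟩ hpq hne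
        have : p ≠ 1 := fun hp => hne (by
          subst hp
          have := Finset.HasAntidiagonal.mem_antidiagonal.mp hpq
          simp only at this
          rw [Prod.mk.injEq]; omega)
        simp [this]
      · intro h
        exact absurd (Finset.HasAntidiagonal.mem_antidiagonal.mpr (by simp only; omega)) h
  · intro k
    have h1 := isBigO_ofReal (𝕜 := 𝕜) ((isBigO_refl h F).mul
      (integral_comp_sub_taylorSum_isBigO (𝕜 := ℝ) hu (N + 1) hhR
      (a := fun t => ((b t : ℕ) : ℝ) - θ t) (b := fun t => ((k : ℕ) : ℝ) - θ t)
      (hbnd.mono fun t ht => ht (b t)) (hbnd.mono fun t ht => ht k)))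
    refine h1.congr' ?_ (Eventually.of_forall fun t => by simp [pow_succ'])
    filter_upwards [hh0, hθ, eventually_forall_mul_mem hhR N
      (eventually_differentiableAt_of_contDiffAt hu)] with t ht h2 h3
    rw [primitiveData_eq_integral ht.ne' h2 fun s hs => (h3 s hs).continuousAt]
    have e1 : ∑ p ∈ Finset.range (N + 1), h t ^ (p + 1) * iteratedDeriv p u x *
        pointMoment (((k : ℕ) : ℝ) - θ t) (p + 1) = h t * ∑ p ∈ Finset.range (N + 1),
        h t ^ p * iteratedDeriv p u x * pointMoment (((k : ℕ) : ℝ) - θ t) (p + 1) := by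
      rw [Finset.mul_sum]
      exact Finset.sum_congr rfl fun p _ => by ring
    have e2 : ∑ p ∈ Finset.range (N + 1 + 1), (h t : 𝕜) ^ p * f t p *
        ((pointMoment (((k : ℕ) : ℝ) - θ t) p : ℝ) : 𝕜) =
        ((h t * ∑ p ∈ Finset.range (N + 1),
          h t ^ p * iteratedDeriv p u x * pointMoment (((k : ℕ) : ℝ) - θ t) (p + 1) +
          h t * f₀ t : ℝ) : 𝕜) := by
      rw [← e1, Finset.sum_range_succ']
      simp only [hf]
      push_cast
      simp [pointMoment]
    rw [e2, ← RCLike.ofReal_sub]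
    congr 1
    simp only [RCLike.ofReal_real_eq_id, id, mul_sub, Finset.sum_sub_distrib, hf₀]
    ring
  · rintro w ⟨hw, hO⟩
    -- The term c_0 λ^(N+1) U(x) of the leading error has an extra factor h and joins the remainder.
    -- Hence the choice of the base interface does not matter to this order.
    have h1 : (fun t => momentError (fun p => if p = 1 then (1 : 𝕜) else 0)
      (fun (i : Fin (N + 1)) p => (pointMoment ((i : ℕ) - θ t) p : 𝕜))
      ((Matrix.of fun (i p : Fin (N + 1)) => pointMoment ((i : ℕ) - θ t) p)⁻¹.map
        (fun r : ℝ => (r : 𝕜))) (N + 1) * (errorCoeff φ (N + 1) 0 * (l t ^ (N + 1) *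
          ((f₀ t : 𝕜) * (h t : 𝕜) ^ (N + 2))))) =O[F] fun t => (h t : 𝕜) ^ (N + 2) :=
      isBigO_one_mul (momentError_isBigO hμ _) ((isBigO_one_mul (by simpa using hl.pow (N + 1))
        (isBigO_one_mul hf₀O (isBigO_refl _ _))).const_mul_left _)
    obtain ⟨C, hC⟩ := (hO.add h1).bound
    refine ⟨C, ?_⟩
    filter_upwards [hw, hC, hh0, momentError_pointMoment (𝕜 := 𝕜) (N := N) hθ] with t h1 h2 h3 h5
    refine primitiveWithin_of_weights h3 h1.1 h1.2 ?_
    rw [h5] at h2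
    rw [norm_pow, RCLike.norm_ofReal, abs_of_pos h3] at h2
    convert h2 using 1
    · rw [Finset.sum_eq_single 1 (fun p _ hp => by simp [hp]) (fun h => absurd (by simp) h),
        sub_add]
      congr 2
      rw [Fin.sum_univ_succ]
      simp only [primitiveSymbol, if_true, hf, Fin.val_zero, Fin.val_succ, iteratedDeriv_zero,
        Nat.add_sub_add_right, Nat.sub_zero]
      push_cast
      ring
    · ring

end

/-! ### Orthogonal polynomials of the Gaussian -/

theorem contDiff_gaussian : ContDiff ℂ ∞ gaussian := by
  unfold gaussian
  fun_prop

theorem hasDerivAt_gaussian (z : ℂ) : HasDerivAt gaussian (-2 * z * gaussian z) z := by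
  have h : HasDerivAt (fun z : ℂ => Complex.exp (-z ^ 2)) _ z := ((hasDerivAt_pow 2 z).fun_neg).cexp
  refine h.congr_deriv ?_
  simp only [gaussian]
  ring

theorem iteratedDeriv_gaussian_succ_succ (m : ℕ) :
    iteratedDeriv (m + 2) gaussian = fun z =>
      -2 * z * iteratedDeriv (m + 1) gaussian z - 2 * (m + 1) * iteratedDeriv m gaussian z := by
  have hd : ∀ k z, HasDerivAt (iteratedDeriv k gaussian) (iteratedDeriv (k + 1) gaussian z) z :=
    fun k z => by
      rw [iteratedDeriv_succ]
      exact (contDiff_gaussian.differentiable_iteratedDeriv k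
        (by exact_mod_cast WithTop.coe_lt_top _) z).hasDerivAt
  have hrec : ∀ k z, HasDerivAt (fun z => -2 * z * iteratedDeriv k gaussian z)
      (-2 * iteratedDeriv k gaussian z + -2 * z * iteratedDeriv (k + 1) gaussian z) z 
      := fun k z => by
    have h1 : HasDerivAt (fun z : ℂ => -2 * z) (-2) z := by
      simpa using (hasDerivAt_id z).const_mul (-2 : ℂ)
    exact h1.mul (hd k z)
  induction m with
  | zero =>
    have h1 : iteratedDeriv 1 gaussian = fun z => -2 * z * iteratedDeriv 0 gaussian z := by
      ext z
      rw [iteratedDeriv_one, (hasDerivAt_gaussian z).deriv, iteratedDeriv_zero]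
    ext z
    rw [iteratedDeriv_succ, zero_add]
    nth_rewrite 1 [h1]
    rw [(hrec 0 z).deriv]
    push_cast
    ring
  | succ m ih =>
    ext z
    conv_lhs => rw [iteratedDeriv_succ, ih]
    rw [((hrec (m + 1) z).fun_sub ((hd m z).const_mul (2 * ((m : ℂ) + 1)))).deriv]
    push_cast
    ring

/-- The orthogonal polynomials of the moment functional `X ^ k ↦ (e^{-z²})^(k)(0)`. -/
noncomputable def gaussPoly : ℕ → Polynomial ℕ
  | 0 => 1
  | 1 => Polynomial.X
  | n + 2 => Polynomial.X * gaussPoly (n + 1) + Polynomial.C (2 * (n + 1)) * gaussPoly n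

theorem gaussPoly_coeff_zero (n : ℕ) :
    (gaussPoly (n + 2)).coeff 0 = 2 * (n + 1) * (gaussPoly n).coeff 0 := by
  rw [gaussPoly, Polynomial.coeff_add, Polynomial.coeff_C_mul, Polynomial.coeff_X_mul_zero, zero_add]

theorem gaussPoly_coeff_succ (n j : ℕ) : (gaussPoly (n + 2)).coeff (j + 1) =
    (gaussPoly (n + 1)).coeff j + 2 * (n + 1) * (gaussPoly n).coeff (j + 1) := by
  rw [gaussPoly, Polynomial.coeff_add, Polynomial.coeff_C_mul, Polynomial.coeff_X_mul]

theorem gaussPoly_coeff_eq_zero (n : ℕ) : ∀ j, n < j → (gaussPoly n).coeff j = 0 := by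
  induction n using Nat.twoStepInduction with
  | zero => intro j hj; rw [gaussPoly, Polynomial.coeff_one, if_neg (by omega)]
  | one => intro j hj; rw [gaussPoly, Polynomial.coeff_X, if_neg (by omega)]
  | more n ih1 ih2 =>
    intro j hj
    obtain ⟨j, rfl⟩ : ∃ i, j = i + 1 := ⟨j - 1, by omega⟩
    rw [gaussPoly_coeff_succ, ih2 j (by omega), ih1 (j + 1) (by omega), mul_zero, add_zero]

theorem gaussPoly_coeff_self (n : ℕ) : (gaussPoly n).coeff n = 1 := by
  induction n using Nat.twoStepInduction with
  | zero => simp [gaussPoly]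
  | one => simp [gaussPoly]
  | more n ih1 ih2 =>
    rw [gaussPoly_coeff_succ, ih2, gaussPoly_coeff_eq_zero n _ (by omega), mul_zero, add_zero]

/-- The recurrence has only nonnegative terms, and its second term carries positivity from n to n +
2. The cases j = 1 and j = 2 serve the leading coefficients of the direct and primitive symbols. -/
theorem gaussPoly_coeff_pos (j k : ℕ) : 0 < (gaussPoly (j + 2 * k)).coeff j := by
  induction k with
  | zero => rw [mul_zero, add_zero, gaussPoly_coeff_self]; exact one_pos
  | succ k ih =>
    rw [show j + 2 * (k + 1) = j + 2 * k + 2 by ring]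
    cases j with
    | zero => rw [gaussPoly_coeff_zero]; positivity
    | succ j =>
      rw [gaussPoly_coeff_succ]
      exact lt_of_lt_of_le (by positivity) (Nat.le_add_left _ _)

/-- The pairing of `gaussPoly n` with `X ^ i`. -/
noncomputable def gaussPair (n i : ℕ) : ℂ :=
  ∑ j ∈ Finset.range (n + 1), ((gaussPoly n).coeff j : ℂ) * iteratedDeriv (i + j) gaussian 0

theorem gaussPair_eq {n K : ℕ} (hK : n + 1 ≤ K) (i : ℕ) : gaussPair n i =
    ∑ j ∈ Finset.range K, ((gaussPoly n).coeff j : ℂ) * iteratedDeriv (i + j) gaussian 0 := by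
  refine Finset.sum_subset (Finset.range_mono hK) fun j _ hj => ?_
  rw [gaussPoly_coeff_eq_zero n j (by simpa using hj)]
  simp

theorem gaussPair_rec (n i : ℕ) :
    gaussPair (n + 2) i = gaussPair (n + 1) (i + 1) + 2 * (n + 1) * gaussPair n i := by
  rw [gaussPair, gaussPair_eq (n := n + 1) (K := n + 2) le_rfl,
    gaussPair_eq (n := n) (K := n + 3) (by omega), Finset.sum_range_succ' _ (n + 2),
    Finset.sum_range_succ' _ (n + 2), gaussPoly_coeff_zero]
  simp only [gaussPoly_coeff_succ, mul_add, Finset.mul_sum]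
  push_cast
  rw [← add_assoc, ← Finset.sum_add_distrib]
  congr 1
  · refine Finset.sum_congr rfl fun j _ => ?_
    rw [show i + 1 + j = i + (j + 1) by ring]
    ring
  · ring

/-- At 0 the Hermite recurrence reads φ^(i+2)(0) = -2(i+1) φ^(i)(0), and the three-term recurrence
propagates it in n, as an algebraic integration by parts. Iteration gives orthogonality below the
diagonal and (-2)^n n! on it. -/
theorem gaussPair_succ (n : ℕ) : (∀ i, gaussPair (n + 1) (i + 1) = -2 * (i + 1) * gaussPair n i) ∧
    gaussPair (n + 1) 0 = 0 := by
  have h2 : ∀ i : ℕ, iteratedDeriv (i + 2) gaussian 0 = -2 * (i + 1) * iteratedDeriv i gaussian 0 :=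
    fun i => by rw [iteratedDeriv_gaussian_succ_succ]; ring
  have h0 : ∀ i, gaussPair 0 i = iteratedDeriv i gaussian 0 := fun i => by
    simp [gaussPair, gaussPoly]
  have h1 : ∀ i, gaussPair 1 i = iteratedDeriv (i + 1) gaussian 0 := fun i => by
    simp [gaussPair, gaussPoly, Finset.sum_range_succ]
  have h3 : iteratedDeriv 1 gaussian 0 = 0 := by
    rw [iteratedDeriv_one, (hasDerivAt_gaussian 0).deriv]; simp
  induction n using Nat.twoStepInduction with
  | zero => exact ⟨fun i => by rw [zero_add, h1, h0, h2], by rw [zero_add, h1, h3]⟩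
  | one =>
    refine ⟨fun i => ?_, ?_⟩
    · rw [gaussPair_rec 0, zero_add, h1, h1, h0, show i + 1 + 1 + 1 = (i + 1) + 2 by ring, h2]
      push_cast; ring
    · rw [gaussPair_rec 0, zero_add, h1, h0, h2]; push_cast; ring
  | more n ih1 ih2 =>
    refine ⟨fun i => ?_, ?_⟩
    · rw [gaussPair_rec (n + 1), ih2.1, gaussPair_rec n i, ih1.1]
      push_cast
      ring
    · rw [gaussPair_rec (n + 1), ih2.1, ih1.2]
      simp

theorem gaussPair_eq_zero (n : ℕ) : ∀ i, i < n → gaussPair n i = 0 := by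
  induction n with
  | zero => intro i hi; omega
  | succ n ih =>
    intro i hi
    cases i with
    | zero => exact (gaussPair_succ n).2
    | succ i => rw [(gaussPair_succ n).1, ih i (by omega), mul_zero]

theorem gaussPair_self_ne_zero (n : ℕ) : gaussPair n n ≠ 0 := by
  induction n with
  | zero => simp [gaussPair, gaussPoly, gaussian]
  | succ n ih =>
    rw [(gaussPair_succ n).1]
    exact mul_ne_zero (mul_ne_zero (by norm_num) (by exact_mod_cast n.succ_ne_zero)) ih

/-- The coefficient matrix of the orthogonal polynomials turns the Hankel matrix into an upper
triangular one with nonzero diagonal. -/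
theorem det_derivMatrix_gaussian_ne_zero (n : ℕ) : (derivMatrix gaussian n).det ≠ 0 := by
  set L : Matrix (Fin n) (Fin n) ℂ := Matrix.of fun k j => ((gaussPoly k).coeff j : ℂ) with hL
  have hmul : ∀ k i : Fin n, (L * derivMatrix gaussian n) k i = gaussPair k i := fun k i => by
    rw [gaussPair_eq (K := n) k.2, ← Fin.sum_univ_eq_sum_range
      (fun j => ((gaussPoly k).coeff j : ℂ) * iteratedDeriv ((i : ℕ) + j) gaussian 0)]
    simp only [Matrix.mul_apply, hL, derivMatrix, Matrix.of_apply]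
    exact Finset.sum_congr rfl fun j _ => by rw [add_comm (i : ℕ)]
  have htri : (L * derivMatrix gaussian n).BlockTriangular id := fun k i hik => by
    rw [hmul]
    exact gaussPair_eq_zero _ _ hik
  have hdet : (L * derivMatrix gaussian n).det ≠ 0 := by
    rw [Matrix.det_of_isUpperTriangular htri]
    exact Finset.prod_ne_zero_iff.mpr fun i _ => by rw [hmul]; exact gaussPair_self_ne_zero _
  rw [Matrix.det_mul] at hdet
  exact right_ne_zero_of_mul hdet

/-! ### Error coefficients of the Gaussian and of even functions -/

theorem errorCoeff_unique {𝕜 : Type} [RCLike 𝕜] {φ : 𝕜 → 𝕜} {n : ℕ}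
    (hdet : (derivMatrix φ n).det ≠ 0) {c : Fin n → 𝕜}
    (hc : ∀ i : Fin n, ∑ j : Fin n, iteratedDeriv ((i : ℕ) + j) φ 0 * c j =
      iteratedDeriv ((i : ℕ) + n) φ 0) : errorCoeff φ n = c := by
  have h1 : Matrix.mulVec (derivMatrix φ n) c = fun i : Fin n => iteratedDeriv ((i : ℕ) + n) φ 0 := by
    ext i
    rw [← hc i]
    simp only [Matrix.mulVec, dotProduct, derivMatrix, Matrix.of_apply]
  rw [errorCoeff, ← h1, Matrix.mulVec_mulVec,
    Matrix.nonsing_inv_mul _ (isUnit_iff_ne_zero.mpr hdet), Matrix.one_mulVec]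

/-- `gaussPoly n` is monic and orthogonal to X^i for i < n; this is the system defining c, up to
sign. -/
theorem errorCoeff_gaussian (n : ℕ) (j : Fin n) :
    errorCoeff gaussian n j = ((-((gaussPoly n).coeff j : ℝ) : ℝ) : ℂ) := by
  refine congrFun (errorCoeff_unique (det_derivMatrix_gaussian_ne_zero n)
    (c := fun j => ((-((gaussPoly n).coeff j : ℝ) : ℝ) : ℂ)) fun i => ?_) j
  have h1 := gaussPair_eq_zero n i i.2
  rw [gaussPair, Finset.sum_range_succ, gaussPoly_coeff_self, ← Fin.sum_univ_eq_sum_range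
    (fun j => ((gaussPoly n).coeff j : ℂ) * iteratedDeriv ((i : ℕ) + j) gaussian 0)] at h1
  push_cast at h1 ⊢
  simp only [mul_neg, Finset.sum_neg_distrib]
  rw [one_mul] at h1
  rw [eq_neg_of_add_eq_zero_right h1]
  exact congrArg Neg.neg (Finset.sum_congr rfl fun j _ => mul_comm _ _)

/-- The odd derivatives of φ vanish at 0, so (-1)^(j+n) c_j solves the same system as c_j, and
uniqueness identifies the two. -/
theorem errorCoeff_eq_zero_of_odd {𝕜 : Type} [RCLike 𝕜] {φ : 𝕜 → 𝕜} {n : ℕ}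
    (heven : ∀ z, φ (-z) = φ z) (hdet : (derivMatrix φ n).det ≠ 0) (j : Fin n)
    (hj : Odd ((j : ℕ) + n)) : errorCoeff φ n j = 0 := by
  have hodd : ∀ m, Odd m → iteratedDeriv m φ 0 = 0 := fun m hm => by
    have h1 := iteratedDeriv_comp_neg m φ (0 : 𝕜)
    simp only [heven, neg_zero, hm.neg_one_pow, smul_eq_mul, neg_mul, one_mul] at h1
    exact self_eq_neg.mp h1
  have h1 := congrFun (errorCoeff_unique hdet
    (c := fun j => (-1) ^ ((j : ℕ) + n) * errorCoeff φ n j) fun i => ?_) j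
  · simp only [hj.neg_one_pow, neg_mul, one_mul] at h1
    exact self_eq_neg.mp h1
  · have h2 := errorCoeff_sum hdet i
    have h3 : ∀ j : Fin n, iteratedDeriv ((i : ℕ) + j) φ 0 *
        ((-1) ^ ((j : ℕ) + n) * errorCoeff φ n j) =
        (-1) ^ ((i : ℕ) + n) * (errorCoeff φ n j * iteratedDeriv ((j : ℕ) + i) φ 0) := fun j => by
      rw [add_comm (j : ℕ) i]
      rcases Nat.even_or_odd ((i : ℕ) + j) with he | ho
      · have h4 : ((-1 : 𝕜)) ^ ((j : ℕ) + n) = (-1) ^ ((i : ℕ) + n) := by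
          have h5 : Even ((j : ℕ) + n) ↔ Even ((i : ℕ) + n) := by
            rw [Nat.even_add] at he ⊢
            rw [Nat.even_add, he]
          rcases Nat.even_or_odd ((j : ℕ) + n) with h | h
          · rw [h.neg_one_pow, (h5.mp h).neg_one_pow]
          · rw [h.neg_one_pow, (Nat.not_even_iff_odd.mp fun h6 =>
              Nat.not_even_iff_odd.mpr h (h5.mpr h6)).neg_one_pow]
        rw [h4]; ring
      · rw [hodd _ ho]; ring
    rw [Finset.sum_congr rfl fun j _ => h3 j, ← Finset.mul_sum, h2, add_comm n]
    rcases Nat.even_or_odd ((i : ℕ) + n) with he | ho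
    · rw [he.neg_one_pow, one_mul]
    · rw [hodd _ ho, mul_zero]

/-! ### Uniformity in the parameters and order of accuracy -/

/-- The product with a principal filter encodes uniformity over s. With the shape parameter, θ and
the base interface as points of s, one constant and one δ serve all of them. -/
theorem exists_delta_of_eventually {S : Type*} {s : Set S} {p : ℝ → S → Prop}
    (h : ∀ᶠ t in 𝓝[>] (0 : ℝ) ×ˢ 𝓟 s, p t.1 t.2) :
    ∃ δ > (0 : ℝ), ∀ h : ℝ, 0 < h → h < δ → ∀ y ∈ s, p h y := by
  rw [eventually_prod_principal_iff] at h
  obtain ⟨δ, hδ, hsub⟩ := mem_nhdsGT_iff_exists_Ioo_subset.mp h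
  exact ⟨δ, hδ, fun h h0 h1 y hy => hsub ⟨h0, h1⟩ y hy⟩

theorem eventually_snd_mem_principal {R S : Type*} (l : Filter R) (s : Set S) :
    ∀ᶠ t in l ×ˢ 𝓟 s, t.2 ∈ s :=
  tendsto_snd.eventually (mem_principal_self s)

theorem continuous_positionFactor (N : ℕ) : Continuous (positionFactor N) := by
  have h : ContDiff ℝ 1 fun t : ℝ => ∏ k ∈ Finset.range (N + 1), (t - k) := by fun_prop
  have := h.continuous_deriv le_rfl
  unfold positionFactor
  fun_prop

section

variable {𝕜 : Type} [RCLike 𝕜] {N : ℕ} {u : ℝ → ℝ} {a h x : ℝ} {w w' : 𝕜} {ε ε' : ℝ}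

theorem directWithin_of_norm_sub_le {B : ℝ → 𝕜} (H : DirectWithin N B u a h x w ε)
    (hw : ‖w - w'‖ ≤ ε') : DirectWithin N B u a h x w' (ε + ε') := by
  obtain ⟨α, h1, h2, h3⟩ := H
  refine ⟨α, h1, h2, ?_⟩
  rw [← sub_add_sub_cancel _ w]
  exact (norm_add_le _ _).trans (add_le_add h3 hw)

theorem primitiveWithin_of_norm_sub_le {B : ℝ → 𝕜} {b : Fin (N + 1)}
    (H : PrimitiveWithin N B u a h b x w ε) (hw : ‖w - w'‖ ≤ ε') :
    PrimitiveWithin N B u a h b x w' (ε + ε') := by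
  obtain ⟨α, h1, h2, h3⟩ := H
  refine ⟨α, h1, h2, ?_⟩
  rw [← sub_add_sub_cancel _ w]
  exact (norm_add_le _ _).trans (add_le_add h3 hw)

theorem directWithin_mono {B : ℝ → 𝕜} (H : DirectWithin N B u a h x w ε) (hε : ε ≤ ε') :
    DirectWithin N B u a h x w ε' := by
  obtain ⟨α, h1, h2, h3⟩ := H
  exact ⟨α, h1, h2, h3.trans hε⟩

theorem primitiveWithin_mono {B : ℝ → 𝕜} {b : Fin (N + 1)}
    (H : PrimitiveWithin N B u a h b x w ε) (hε : ε ≤ ε') :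
    PrimitiveWithin N B u a h b x w ε' := by
  obtain ⟨α, h1, h2, h3⟩ := H
  exact ⟨α, h1, h2, h3.trans hε⟩

/-- Uniqueness of the coefficients makes both hypotheses speak of the same value AU'(x). -/
theorem norm_sub_le_of_primitiveWithin {B : ℝ → 𝕜} {b : Fin (N + 1)}
    (H : PrimitiveWithin N B u a h b x w ε) (H' : PrimitiveWithin N B u a h b x w' ε') :
    ‖w - w'‖ ≤ ε + ε' := by
  obtain ⟨α, h1, h2, h3⟩ := H
  obtain ⟨α', h1', -, h3'⟩ := H'
  obtain rfl := h2 _ h1'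
  rw [← sub_add_sub_cancel _ (rbfSum (deriv B) (face a h) α' x)]
  rw [norm_sub_rev] at h3
  exact (norm_add_le _ _).trans (add_le_add h3 h3')

end

section

variable {𝕜 : Type} [RCLike 𝕜] {φ : 𝕜 → 𝕜} {N : ℕ} {u : ℝ → ℝ} {x : ℝ}

theorem directWithin_uniform (hφ : ContDiffAt 𝕜 ∞ φ 0) (hdet : (derivMatrix φ N).det ≠ 0)
    (hu : ContDiffAt ℝ ∞ u x) (M : ℝ) :
    ∃ C > (0 : ℝ), ∃ δ > (0 : ℝ), ∀ h : ℝ, 0 < h → h < δ →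
      ∀ l : 𝕜, l ≠ 0 → ‖l‖ ≤ M → ∀ θ ∈ Set.Icc (0 : ℝ) N,
        DirectWithin N (shaped φ l) u (x - θ * h) h x
          ((u x : 𝕜) + (positionFactor N θ * h ^ N : ℝ) * directSymbol N φ u x l)
          (C * h ^ (N + 1)) := by
  set s : Set (𝕜 × ℝ) := {y | (y.1 ≠ 0 ∧ ‖y.1‖ ≤ M) ∧ y.2 ∈ Set.Icc (0 : ℝ) N} with hs
  have hmem := eventually_snd_mem_principal (𝓝[>] (0 : ℝ)) s
  obtain ⟨C, hC⟩ := eventually_directWithin (T := ℝ × (𝕜 × ℝ)) (F := 𝓝[>] (0 : ℝ) ×ˢ 𝓟 s) hφ hdet hu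
    (h := fun t => t.1) (θ := fun t => t.2.2) (l := fun t => t.2.1) tendsto_fst
    (IsBigO.of_bound M (hmem.mono fun t ht => by simpa using ht.1.2))
    (hmem.mono fun t ht => ht.1.1) (hmem.mono fun t ht => ht.2)
  obtain ⟨δ, hδ, H⟩ := exists_delta_of_eventually (S := 𝕜 × ℝ) (s := s)
    (p := fun h y => DirectWithin N (shaped φ y.1) u
    (x - y.2 * h) h x ((u x : 𝕜) + (positionFactor N y.2 * h ^ N : ℝ) * directSymbol N φ u x y.1)
    (C * h ^ (N + 1))) hC
  refine ⟨max C 1, by positivity, δ, hδ, fun h h0 h1 l hl hlM θ hθ => ?_⟩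
  exact directWithin_mono (H h h0 h1 (l, θ) ⟨⟨hl, hlM⟩, hθ⟩) (by gcongr; exact le_max_left _ _)

theorem primitiveWithin_uniform (hφ : ContDiffAt 𝕜 ∞ φ 0)
    (hdet : (derivMatrix φ (N + 1)).det ≠ 0) (hu : ContDiffAt ℝ ∞ u x) (M : ℝ) :
    ∃ C > (0 : ℝ), ∃ δ > (0 : ℝ), ∀ h : ℝ, 0 < h → h < δ →
      ∀ l : 𝕜, l ≠ 0 → ‖l‖ ≤ M → ∀ θ ∈ Set.Icc (0 : ℝ) N, ∀ b : Fin (N + 1),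
        PrimitiveWithin N (shaped φ l) u (x - θ * h) h b x
          ((u x : 𝕜) + (positionFactor N θ * h ^ N : ℝ) * primitiveSymbol N φ u x l)
          (C * h ^ (N + 1)) := by
  set s : Set (𝕜 × ℝ × Fin (N + 1)) :=
    {y | (y.1 ≠ 0 ∧ ‖y.1‖ ≤ M) ∧ y.2.1 ∈ Set.Icc (0 : ℝ) N} with hs
  have hmem := eventually_snd_mem_principal (𝓝[>] (0 : ℝ)) s
  obtain ⟨C, hC⟩ := eventually_primitiveWithin (T := ℝ × (𝕜 × ℝ × Fin (N + 1)))
    (F := 𝓝[>] (0 : ℝ) ×ˢ 𝓟 s) hφ hdet hu (h := fun t => t.1) (θ := fun t => t.2.2.1)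
    (l := fun t => t.2.1) (b := fun t => t.2.2.2) tendsto_fst
    (IsBigO.of_bound M (hmem.mono fun t ht => by simpa using ht.1.2))
    (hmem.mono fun t ht => ht.1.1) (hmem.mono fun t ht => ht.2)
  obtain ⟨δ, hδ, H⟩ := exists_delta_of_eventually (S := 𝕜 × ℝ × Fin (N + 1)) (s := s)
    (p := fun h y => PrimitiveWithin N
    (shaped φ y.1) u (x - y.2.1 * h) h y.2.2 x
    ((u x : 𝕜) + (positionFactor N y.2.1 * h ^ N : ℝ) * primitiveSymbol N φ u x y.1)
    (C * h ^ (N + 1))) hC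
  refine ⟨max C 1, by positivity, δ, hδ, fun h h0 h1 l hl hlM θ hθ b => ?_⟩
  exact primitiveWithin_mono (H h h0 h1 (l, θ, b) ⟨⟨hl, hlM⟩, hθ⟩)
    (by gcongr; exact le_max_left _ _)

theorem norm_leading_term_le {K c h θ : ℝ} {S : 𝕜} (hK : |positionFactor N θ| ≤ K) (h0 : 0 < h)
    (hS : ‖S‖ ≤ c * h) :
    ‖((u x : 𝕜) + (positionFactor N θ * h ^ N : ℝ) * S) - (u x : 𝕜)‖ ≤ K * c * h ^ (N + 1) := by
  rw [add_sub_cancel_left, norm_mul, RCLike.norm_ofReal, abs_mul, abs_of_pos (pow_pos h0 N)]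
  have hK0 : 0 ≤ K := (abs_nonneg _).trans hK
  calc |positionFactor N θ| * h ^ N * ‖S‖ ≤ K * h ^ N * (c * h) := by gcongr
    _ = _ := by ring

theorem exists_eventually_bounds {l S : ℝ → 𝕜} (hl0 : ∀ᶠ h in 𝓝[>] (0 : ℝ), l h ≠ 0)
    (hl : l =O[𝓝[>] (0 : ℝ)] fun _ => (1 : ℝ)) (hS : S =O[𝓝[>] (0 : ℝ)] fun h => h) :
    ∃ M c δ : ℝ, 0 < c ∧ 0 < δ ∧
      ∀ h, 0 < h → h < δ → l h ≠ 0 ∧ ‖l h‖ ≤ M ∧ ‖S h‖ ≤ c * h := by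
  obtain ⟨M, hM⟩ := hl.bound
  obtain ⟨c, hc, hcS⟩ := hS.exists_pos
  obtain ⟨δ, hδ, hsub⟩ := mem_nhdsGT_iff_exists_Ioo_subset.mp ((hl0.and hM).and hcS.bound)
  refine ⟨M, c, δ, hc, hδ, fun h h0 h1 => ?_⟩
  obtain ⟨⟨h2, h3⟩, h4⟩ := hsub ⟨h0, h1⟩
  exact ⟨h2, by simpa using h3, by simpa [abs_of_pos h0] using h4⟩

theorem directOrder_of_symbol (hφ : ContDiffAt 𝕜 ∞ φ 0) (hdet : (derivMatrix φ N).det ≠ 0)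
    (hu : ContDiffAt ℝ ∞ u x) {l : ℝ → 𝕜} (hl0 : ∀ᶠ h in 𝓝[>] (0 : ℝ), l h ≠ 0)
    (hl : l =O[𝓝[>] (0 : ℝ)] fun _ => (1 : ℝ))
    (hS : (fun h => directSymbol N φ u x (l h)) =O[𝓝[>] (0 : ℝ)] fun h => h) :
    DirectOrder N φ l u x (N + 1) := by
  obtain ⟨M, c, δ', hc, hδ', H'⟩ := exists_eventually_bounds hl0 hl hS
  obtain ⟨C, hC, δ, hδ, H⟩ := directWithin_uniform hφ hdet hu M
  obtain ⟨K, hK⟩ := (isCompact_Icc (a := (0 : ℝ)) (b := N)).exists_bound_of_continuousOn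
    (continuous_positionFactor N).continuousOn
  have hK0 : 0 ≤ K := (norm_nonneg _).trans (hK 0 ⟨le_rfl, Nat.cast_nonneg _⟩)
  refine ⟨C + K * c, by positivity, min δ δ', lt_min hδ hδ', fun h h0 h1 θ hθ => ?_⟩
  obtain ⟨h2, h3, h4⟩ := H' h h0 (h1.trans_le (min_le_right _ _))
  rw [add_mul]
  exact directWithin_of_norm_sub_le (H h h0 (h1.trans_le (min_le_left _ _)) (l h) h2 h3 θ hθ)
    (norm_leading_term_le (hK θ hθ) h0 h4)

theorem primitiveOrder_of_symbol (hφ : ContDiffAt 𝕜 ∞ φ 0)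
    (hdet : (derivMatrix φ (N + 1)).det ≠ 0)
    (hu : ContDiffAt ℝ ∞ u x) {l : ℝ → 𝕜} (hl0 : ∀ᶠ h in 𝓝[>] (0 : ℝ), l h ≠ 0)
    (hl : l =O[𝓝[>] (0 : ℝ)] fun _ => (1 : ℝ))
    (hS : (fun h => primitiveSymbol N φ u x (l h)) =O[𝓝[>] (0 : ℝ)] fun h => h) :
    PrimitiveOrder N φ l u x (N + 1) := by
  obtain ⟨M, c, δ', hc, hδ', H'⟩ := exists_eventually_bounds hl0 hl hS
  obtain ⟨C, hC, δ, hδ, H⟩ := primitiveWithin_uniform hφ hdet hu M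
  obtain ⟨K, hK⟩ := (isCompact_Icc (a := (0 : ℝ)) (b := N)).exists_bound_of_continuousOn
    (continuous_positionFactor N).continuousOn
  have hK0 : 0 ≤ K := (norm_nonneg _).trans (hK 0 ⟨le_rfl, Nat.cast_nonneg _⟩)
  refine ⟨C + K * c, by positivity, min δ δ', lt_min hδ hδ', fun h h0 h1 θ hθ b => ?_⟩
  obtain ⟨h2, h3, h4⟩ := H' h h0 (h1.trans_le (min_le_right _ _))
  rw [add_mul]
  exact primitiveWithin_of_norm_sub_le (H h h0 (h1.trans_le (min_le_left _ _)) (l h) h2 h3 θ hθ b)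
    (norm_leading_term_le (hK θ hθ) h0 h4)

end

/-! ### The symbol as a polynomial in λ² and its roots -/

/-- The symbol as a polynomial in the square of the shape parameter. -/
noncomputable def symbolPoly {R : Type*} [CommRing R] (N : ℕ) (c : Fin N → R) (a : ℕ → R) :
    Polynomial R :=
  Polynomial.C (a N) - ∑ j : Fin N, Polynomial.C (c j * a j) * Polynomial.X ^ ((N - (j : ℕ)) / 2)

section

variable {R : Type*} [CommRing R] {N : ℕ} {c : Fin N → R} {a : ℕ → R}

/-- Only odd j contribute, and then N - j is even; the rounding in (N - j) / 2 affects only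
vanishing terms. -/
theorem symbolPoly_eval_sq (hN : Odd N) (hc : ∀ j : Fin N, Even (j : ℕ) → c j = 0) (l : R) :
    (symbolPoly N c a).eval (l ^ 2) = a N - ∑ j : Fin N, c j * l ^ (N - (j : ℕ)) * a j := by
  simp only [symbolPoly, Polynomial.eval_sub, Polynomial.eval_C, Polynomial.eval_finsetSum,
    Polynomial.eval_mul, Polynomial.eval_pow, Polynomial.eval_X]
  congr 1
  refine Finset.sum_congr rfl fun j _ => ?_
  rcases Nat.even_or_odd (j : ℕ) with he | ho
  · rw [hc j he]; ring
  · have h1 : Even (N - (j : ℕ)) := hN.tsub_odd ho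
    rw [← pow_mul, Nat.mul_div_cancel' h1.two_dvd]
    ring

/-- j = 1 is the least odd index and so has the highest exponent; N ≥ 3 separates it from the
constant term. -/
theorem symbolPoly_coeff (hN3 : 3 ≤ N) (hN1 : 1 < N)
    (hc : ∀ j : Fin N, Even (j : ℕ) → c j = 0) :
    (symbolPoly N c a).coeff ((N - 1) / 2) = -(c ⟨1, hN1⟩ * a 1) := by
  rw [symbolPoly, Polynomial.coeff_sub, Polynomial.coeff_C, if_neg (by omega), zero_sub,
    Polynomial.finsetSum_coeff, Finset.sum_eq_single ⟨1, hN1⟩]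
  · rw [Polynomial.coeff_C_mul, Polynomial.coeff_X_pow, if_pos rfl, mul_one]
  · intro j _ hj
    rcases Nat.even_or_odd (j : ℕ) with he | ho
    · simp [hc j he]
    · rw [Polynomial.coeff_C_mul, Polynomial.coeff_X_pow, if_neg, mul_zero]
      have hj1 : (j : ℕ) ≠ 1 := fun h => hj (Fin.ext h)
      have hj2 := j.2
      obtain ⟨i, hi⟩ := ho
      omega
  · intro h; exact absurd (Finset.mem_univ _) h

theorem symbolPoly_natDegree (hN3 : 3 ≤ N) (hN1 : 1 < N)
    (hc : ∀ j : Fin N, Even (j : ℕ) → c j = 0) (h : c ⟨1, hN1⟩ * a 1 ≠ 0) :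
    (symbolPoly N c a).natDegree = (N - 1) / 2 := by
  refine le_antisymm ?_ (Polynomial.le_natDegree_of_ne_zero ?_)
  · refine (Polynomial.natDegree_sub_le _ _).trans (max_le (by simp) ?_)
    refine Polynomial.natDegree_sum_le_of_forall_le _ _ fun j _ => ?_
    rcases Nat.even_or_odd (j : ℕ) with he | ho
    · simp [hc j he]
    · refine (Polynomial.natDegree_C_mul_X_pow_le _ _).trans ?_
      obtain ⟨i, hi⟩ := ho
      omega
  · rw [symbolPoly_coeff hN3 hN1 hc]
    exact neg_ne_zero.mpr h

end

theorem exists_real_root_of_odd_natDegree {P : Polynomial ℝ} (hP : Odd P.natDegree) :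
    ∃ s, P.eval s = 0 := by
  wlog hpos : 0 ≤ P.leadingCoeff generalizing P
  · obtain ⟨s, hs⟩ := this (P := -P) (by rwa [Polynomial.natDegree_neg])
      (by rw [Polynomial.leadingCoeff_neg]; linarith)
    exact ⟨s, by simpa using hs⟩
  have hdeg : 0 < P.degree := Polynomial.natDegree_pos_iff_degree_pos.mp hP.pos
  have h1 := P.tendsto_atTop_of_leadingCoeff_nonneg hdeg hpos
  have hnd : (P.comp (-Polynomial.X)).natDegree = P.natDegree := by
    rw [Polynomial.natDegree_comp]; simp
  have h2 := (P.comp (-Polynomial.X)).tendsto_atBot_of_leadingCoeff_nonpos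
    (Polynomial.natDegree_pos_iff_degree_pos.mp (hnd ▸ hP.pos)) (by
      rw [Polynomial.leadingCoeff_comp (by simp)]
      simp [hP.neg_one_pow, hpos])
  obtain ⟨s₁, hs₁⟩ := (h1.eventually_ge_atTop 0).exists
  obtain ⟨s₂, hs₂⟩ := (h2.eventually_le_atBot 0).exists
  rw [Polynomial.eval_comp] at hs₂
  exact mem_range_of_exists_le_of_exists_ge P.continuous ⟨_, hs₂⟩ ⟨_, hs₁⟩

/-- Split off the factor X - s₀; the cofactor is bounded near s₀. -/
theorem eval_isBigO_of_root {𝕜 : Type*} [RCLike 𝕜] {P : Polynomial 𝕜} {s₀ : 𝕜}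
    (h₀ : P.eval s₀ = 0) {s : ℝ → 𝕜}
    (hs : (fun h => s h - s₀) =O[𝓝[>] (0 : ℝ)] fun h => h) :
    (fun h => P.eval (s h)) =O[𝓝[>] (0 : ℝ)] fun h => h := by
  obtain ⟨Q, rfl⟩ := Polynomial.dvd_iff_isRoot.mpr h₀
  have hlim : Tendsto s (𝓝[>] (0 : ℝ)) (𝓝 s₀) :=
    tendsto_sub_nhds_zero_iff.mp (hs.trans_tendsto nhdsWithin_le_nhds)
  have h1 := ((Q.continuous.tendsto s₀).comp hlim).isBigO_one ℝ
  simpa using hs.mul h1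

theorem isBigO_one_of_sq {𝕜 : Type*} [RCLike 𝕜] {l₀ : 𝕜} {l : ℝ → 𝕜}
    (hs : (fun h => l h ^ 2 - l₀ ^ 2) =O[𝓝[>] (0 : ℝ)] fun h => h) :
    l =O[𝓝[>] (0 : ℝ)] fun _ => (1 : ℝ) := by
  have hlim : Tendsto (fun h => l h ^ 2) (𝓝[>] (0 : ℝ)) (𝓝 (l₀ ^ 2)) :=
    tendsto_sub_nhds_zero_iff.mp (hs.trans_tendsto nhdsWithin_le_nhds)
  refine IsBigO.of_pow two_ne_zero ?_
  exact (hlim.isBigO_one ℝ).congr_right fun _ => by simp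

/-- The constant l₀ serves unless it is 0, which is not an admissible shape parameter. Then min(|h|,
1) is real, bounded, nonzero for h > 0, and has square O(h). -/
theorem exists_shape_parameters (l₀ : ℂ) : ∃ l : ℝ → ℂ, (∃ M : ℝ, ∀ h, ‖l h‖ ≤ M) ∧
    ((l₀ ^ 2).im = 0 → ∀ h, (l h ^ 2).im = 0) ∧ (∀ᶠ h in 𝓝[>] (0 : ℝ), l h ≠ 0) ∧
    (fun h => l h ^ 2 - l₀ ^ 2) =O[𝓝[>] (0 : ℝ)] fun h => h := by
  by_cases h0 : l₀ = 0
  · refine ⟨fun h => ((min |h| 1 : ℝ) : ℂ), ⟨1, fun h => ?_⟩, fun _ h => ?_, ?_, ?_⟩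
    · rw [Complex.norm_real, Real.norm_of_nonneg (by positivity)]
      exact min_le_right _ _
    · rw [← Complex.ofReal_pow, Complex.ofReal_im]
    · filter_upwards [self_mem_nhdsWithin] with h hh
      have h1 : 0 < |h| := abs_pos.mpr (ne_of_gt hh)
      exact_mod_cast (lt_min h1 one_pos).ne'
    · refine IsBigO.of_bound 1 (Eventually.of_forall fun h => ?_)
      rw [h0, zero_pow two_ne_zero, sub_zero, norm_pow, Complex.norm_real,
        Real.norm_of_nonneg (by positivity), one_mul, Real.norm_eq_abs, sq]
      calc min |h| 1 * min |h| 1 ≤ |h| * 1 := by gcongr; exacts [min_le_left _ _, min_le_right _ _]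
        _ = |h| := mul_one _
  · exact ⟨fun _ => l₀, ⟨‖l₀‖, fun _ => le_rfl⟩, fun h _ => h, Eventually.of_forall fun _ => h0,
      by simpa using isBigO_zero _ _⟩

section

variable {𝕜 : Type} [RCLike 𝕜] {φ : 𝕜 → 𝕜} {N : ℕ} {u : ℝ → ℝ} {x : ℝ}

theorem directSymbol_eq_eval (heven : ∀ z, φ (-z) = φ z) (hN : Odd N)
    (hdet : (derivMatrix φ N).det ≠ 0) (l : 𝕜) : directSymbol N φ u x l =
      (symbolPoly N (errorCoeff φ N) fun j => ((iteratedDeriv j u x : ℝ) : 𝕜)).eval (l ^ 2) :=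
  (symbolPoly_eval_sq hN (a := fun j => ((iteratedDeriv j u x : ℝ) : 𝕜))
    (fun j hj => errorCoeff_eq_zero_of_odd heven hdet j (hj.add_odd hN)) l).symm

theorem errorCoeff_succ_eq_zero (heven : ∀ z, φ (-z) = φ z) (hN : Odd N)
    (hdet : (derivMatrix φ (N + 1)).det ≠ 0) (j : Fin N) (hj : Even (j : ℕ)) :
    errorCoeff φ (N + 1) j.succ = 0 := by
  refine errorCoeff_eq_zero_of_odd heven hdet _ ?_
  rw [Fin.val_succ, add_add_add_comm]
  exact (hj.add_odd hN).add_even (by decide)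

theorem primitiveSymbol_eq_eval (heven : ∀ z, φ (-z) = φ z) (hN : Odd N)
    (hdet : (derivMatrix φ (N + 1)).det ≠ 0) (l : 𝕜) : primitiveSymbol N φ u x l =
      (symbolPoly N (fun j => errorCoeff φ (N + 1) j.succ)
        fun j => ((iteratedDeriv j u x : ℝ) : 𝕜)).eval (l ^ 2) :=
  (symbolPoly_eval_sq hN (a := fun j => ((iteratedDeriv j u x : ℝ) : 𝕜))
    (errorCoeff_succ_eq_zero heven hN hdet) l).symm

theorem directOrder_of_sq_sub_isBigO (hφ : ContDiffAt 𝕜 ∞ φ 0) (heven : ∀ z, φ (-z) = φ z)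
    (hN : Odd N) (hdet : (derivMatrix φ N).det ≠ 0) (hu : ContDiffAt ℝ ∞ u x) {l₀ : 𝕜}
    (h₀ : directSymbol N φ u x l₀ = 0) {l : ℝ → 𝕜} (hl0 : ∀ᶠ h in 𝓝[>] (0 : ℝ), l h ≠ 0)
    (hl : (fun h => l h ^ 2 - l₀ ^ 2) =O[𝓝[>] (0 : ℝ)] fun h => h) :
    DirectOrder N φ l u x (N + 1) := by
  refine directOrder_of_symbol hφ hdet hu hl0 (isBigO_one_of_sq hl) ?_
  rw [directSymbol_eq_eval heven hN hdet] at h₀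
  simp only [directSymbol_eq_eval heven hN hdet]
  exact eval_isBigO_of_root h₀ hl

theorem primitiveOrder_of_sq_sub_isBigO (hφ : ContDiffAt 𝕜 ∞ φ 0) (heven : ∀ z, φ (-z) = φ z)
    (hN : Odd N) (hdet : (derivMatrix φ (N + 1)).det ≠ 0) (hu : ContDiffAt ℝ ∞ u x) {l₀ : 𝕜}
    (h₀ : primitiveSymbol N φ u x l₀ = 0) {l : ℝ → 𝕜} (hl0 : ∀ᶠ h in 𝓝[>] (0 : ℝ), l h ≠ 0)
    (hl : (fun h => l h ^ 2 - l₀ ^ 2) =O[𝓝[>] (0 : ℝ)] fun h => h) :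
    PrimitiveOrder N φ l u x (N + 1) := by
  refine primitiveOrder_of_symbol hφ hdet hu hl0 (isBigO_one_of_sq hl) ?_
  rw [primitiveSymbol_eq_eval heven hN hdet] at h₀
  simp only [primitiveSymbol_eq_eval heven hN hdet]
  exact eval_isBigO_of_root h₀ hl

end

theorem exists_sq_eval_symbolPoly_eq_zero {N : ℕ} (hN3 : 3 ≤ N) (hN1 : 1 < N) {c : Fin N → ℂ}
    {a : ℕ → ℂ} (hc : ∀ j : Fin N, Even (j : ℕ) → c j = 0) (h : c ⟨1, hN1⟩ * a 1 ≠ 0) :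
    ∃ l₀ : ℂ, (symbolPoly N c a).eval (l₀ ^ 2) = 0 := by
  obtain ⟨s, hs⟩ := IsAlgClosed.exists_root (symbolPoly N c a) (by
    intro hd
    have := Polynomial.natDegree_eq_zero_iff_degree_le_zero.mpr hd.le
    rw [symbolPoly_natDegree hN3 hN1 hc h] at this
    omega)
  obtain ⟨l₀, rfl⟩ := IsAlgClosed.exists_pow_nat_eq s two_pos
  exact ⟨l₀, hs⟩

/-- The degree (N - 1)/2 is odd exactly when N ≡ 3 mod 4, so there is a real root s; l₀ is a square
root of s, real or imaginary. -/
theorem exists_real_sq_eval_symbolPoly_eq_zero {N : ℕ} (hN3 : 3 ≤ N) (hN1 : 1 < N) (hN4 : N % 4 = 3)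
    {c : Fin N → ℝ} {a : ℕ → ℝ} (hc : ∀ j : Fin N, Even (j : ℕ) → c j = 0)
    (h : c ⟨1, hN1⟩ * a 1 ≠ 0) :
    ∃ l₀ : ℂ, (l₀ ^ 2).im = 0 ∧
      (symbolPoly N (fun j => (c j : ℂ)) fun j => (a j : ℂ)).eval (l₀ ^ 2) = 0 := by
  obtain ⟨s, hs⟩ := exists_real_root_of_odd_natDegree (P := symbolPoly N c a) (by
    rw [symbolPoly_natDegree hN3 hN1 hc h, Nat.odd_iff]; omega)
  obtain ⟨l₀, hl₀⟩ := IsAlgClosed.exists_pow_nat_eq (s : ℂ) two_pos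
  refine ⟨l₀, by rw [hl₀, Complex.ofReal_im], ?_⟩
  rw [hl₀, ← Complex.ofReal_zero, ← hs]
  simp [symbolPoly, Polynomial.eval_finsetSum]

theorem gaussian_neg (z : ℂ) : gaussian (-z) = gaussian z := by
  simp [gaussian]

/-- The index map `e` is the identity for the direct method and `Fin.succ` for the primitive one. -/
theorem exists_root_of_gaussian_coeff {N n : ℕ} (hN3 : 3 ≤ N) (hN1 : 1 < N) {e : Fin N → Fin n}
    {u : ℝ → ℝ} {x : ℝ} (hc : ∀ j : Fin N, Even (j : ℕ) → errorCoeff gaussian n (e j) = 0)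
    (hpos : 0 < (gaussPoly n).coeff (e ⟨1, hN1⟩)) (hux : deriv u x ≠ 0) :
    ∃ l₀ : ℂ, (N % 4 = 3 → (l₀ ^ 2).im = 0) ∧
      (symbolPoly N (fun j => errorCoeff gaussian n (e j))
        fun j => ((iteratedDeriv j u x : ℝ) : ℂ)).eval (l₀ ^ 2) = 0 := by
  have h1 : -((gaussPoly n).coeff (e ⟨1, hN1⟩) : ℝ) * iteratedDeriv 1 u x ≠ 0 := by
    rw [iteratedDeriv_one]
    exact mul_ne_zero (neg_ne_zero.mpr (by exact_mod_cast hpos.ne')) hux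
  by_cases hN4 : N % 4 = 3
  · obtain ⟨l₀, h2, h3⟩ := exists_real_sq_eval_symbolPoly_eq_zero hN3 hN1 hN4
      (c := fun j => -((gaussPoly n).coeff (e j) : ℝ)) (a := fun j => iteratedDeriv j u x)
      (fun j hj => by
        have := hc j hj
        rw [errorCoeff_gaussian] at this
        exact_mod_cast this) h1
    refine ⟨l₀, fun _ => h2, ?_⟩
    simp only [errorCoeff_gaussian]
    exact h3
  · obtain ⟨l₀, h3⟩ := exists_sq_eval_symbolPoly_eq_zero hN3 hN1
      (c := fun j => errorCoeff gaussian n (e j)) (a := fun j => ((iteratedDeriv j u x : ℝ) : ℂ))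
      hc (by rw [errorCoeff_gaussian]; exact_mod_cast h1)
    exact ⟨l₀, fun h => absurd h hN4, h3⟩

/-! ### Real Gaussian, three cells -/

section

variable {𝕜 : Type} [RCLike 𝕜]

theorem rbfSum_ofReal {n : ℕ} (B : ℝ → ℝ) (X : ℕ → ℝ) (α : Fin n → ℝ) (y : ℝ) :
    rbfSum (fun y => (B y : 𝕜)) X (fun k => (α k : 𝕜)) y = ((rbfSum B X α y : ℝ) : 𝕜) := by
  simp [rbfSum]

theorem re_rbfSum {n : ℕ} (B : ℝ → ℝ) (X : ℕ → ℝ) (α : Fin n → 𝕜) (y : ℝ) :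
    RCLike.re (rbfSum (fun y => (B y : 𝕜)) X α y) = rbfSum B X (fun k => RCLike.re (α k)) y := by
  simp [rbfSum, RCLike.mul_re]

/-- With a real basis function and real data, the real parts of the coefficients solve the system,
and taking real parts does not increase distances. This covers s < 0, where λ is imaginary but the
basis function is real. -/
theorem primitiveWithin_re {N : ℕ} {B : ℝ → ℝ} (hB : Differentiable ℝ B) {u : ℝ → ℝ} {a h x : ℝ}
    {b : Fin (N + 1)} {W ε : ℝ}
    (H : PrimitiveWithin N (fun y => (B y : 𝕜)) u a h b x (W : 𝕜) ε) :
    PrimitiveWithin N B u a h b x W ε := by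
  obtain ⟨α, h1, h2, h3⟩ := H
  have hd : deriv (fun y => (B y : 𝕜)) = fun y => ((deriv B y : ℝ) : 𝕜) := by
    ext y
    exact ((RCLike.ofRealCLM (K := 𝕜)).hasFDerivAt.comp_hasDerivAt y (hB y).hasDerivAt).deriv
  refine ⟨fun k => RCLike.re (α k), fun k => ?_, fun β hβ => ?_, ?_⟩
  · have := congrArg RCLike.re (h1 k)
    rw [re_rbfSum, RCLike.ofReal_re] at this
    exact this
  · have := h2 (fun k => (β k : 𝕜)) fun k => by
      rw [rbfSum_ofReal, hβ k]
      simp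
    ext k
    have h4 := congrArg RCLike.re (congrFun this k)
    rwa [RCLike.ofReal_re] at h4
  · rw [hd] at h3
    refine le_trans ?_ h3
    rw [← re_rbfSum (𝕜 := 𝕜), Real.norm_eq_abs]
    refine le_trans (le_of_eq ?_) (RCLike.abs_re_le_norm _)
    rw [map_sub, RCLike.ofReal_re]

end

theorem positionFactor_three_two : positionFactor 3 2 = 1 / 12 := by
  have h : HasDerivAt (fun t : ℝ => ∏ k ∈ Finset.range (3 + 1), (t - k)) (-2) 2 := by
    have e : (fun t : ℝ => ∏ k ∈ Finset.range (3 + 1), (t - k)) =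
        fun t => t ^ 4 - 6 * t ^ 3 + 11 * t ^ 2 - 6 * t := by
      ext t
      simp [Finset.prod_range_succ]
      ring
    rw [e]
    refine HasDerivAt.congr_deriv (((((hasDerivAt_pow 4 (2 : ℝ)).fun_sub
      ((hasDerivAt_pow 3 2).const_mul 6)).fun_add ((hasDerivAt_pow 2 2).const_mul 11)).fun_sub
      ((hasDerivAt_id' 2).const_mul 6))) ?_
    norm_num
  rw [positionFactor, h.deriv]
  norm_num [Nat.factorial]

/-- `gaussPoly 4` is X⁴ + 12X² + 12; the shift of index by one pairs the 12 of X² with u'. -/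
theorem primitiveSymbol_gaussian_three (u : ℝ → ℝ) (x : ℝ) (l : ℂ) :
    primitiveSymbol 3 gaussian u x l =
      ((iteratedDeriv 3 u x : ℝ) : ℂ) + 12 * l ^ 2 * ((deriv u x : ℝ) : ℂ) := by
  have h1 : (gaussPoly 4).coeff 1 = 0 := by simp [gaussPoly, Polynomial.coeff_X]
  have h2 : (gaussPoly 4).coeff 2 = 12 := by simp [gaussPoly, Polynomial.coeff_X]
  have h3 : (gaussPoly 4).coeff 3 = 0 := by simp [gaussPoly, Polynomial.coeff_X]
  simp only [primitiveSymbol, errorCoeff_gaussian, Fin.sum_univ_three, Fin.val_succ, Fin.val_zero,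
    Fin.val_one, Fin.val_two, h1, h2, h3, iteratedDeriv_one]
  simp

theorem shaped_gaussian_eq {l : ℂ} {s : ℝ} (h : l ^ 2 = s) :
    shaped gaussian l = fun y => ((realGaussian s y : ℝ) : ℂ) := by
  ext y
  simp only [shaped, gaussian, realGaussian]
  push_cast
  congr 1
  rw [mul_pow]
  change -(l ^ 2 * (y : ℂ) ^ 2) = _
  rw [h]
  ring

theorem differentiable_realGaussian (s : ℝ) : Differentiable ℝ (realGaussian s) := by
  unfold realGaussian
  fun_prop

/-- The leading error term for the Gaussian, three cells, at an interface. -/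
theorem primitiveWithin_realGaussian {u : ℝ → ℝ} {x : ℝ} (hu : ContDiffAt ℝ ∞ u x) (M : ℝ) :
    ∃ C > (0 : ℝ), ∃ δ > (0 : ℝ), ∀ h : ℝ, 0 < h → h < δ → ∀ s : ℝ, s ≠ 0 → |s| ≤ M →
      PrimitiveWithin 3 (realGaussian s) u (x - 2 * h) h 1 x
        (u x + h ^ 3 * (s * deriv u x + iteratedDeriv 3 u x / 12)) (C * h ^ 4) := by
  obtain ⟨C, hC, δ, hδ, H⟩ := primitiveWithin_uniform (N := 3) contDiff_gaussian.contDiffAt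
    (det_derivMatrix_gaussian_ne_zero 4) hu (M + 1)
  refine ⟨C, hC, δ, hδ, fun h h0 h1 s hs hsM => ?_⟩
  obtain ⟨l, hl⟩ := IsAlgClosed.exists_pow_nat_eq (s : ℂ) two_pos
  have hl0 : l ≠ 0 := by
    rintro rfl
    rw [zero_pow two_ne_zero] at hl
    exact hs (by exact_mod_cast hl.symm)
  -- ‖l‖² = |s| ≤ M gives ‖l‖ ≤ M + 1 without a square root.
  have hlM : ‖l‖ ≤ M + 1 := by
    have h2 : ‖l‖ ^ 2 = |s| := by rw [← norm_pow, hl, Complex.norm_real, Real.norm_eq_abs]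
    have h3 : 0 ≤ M := (abs_nonneg s).trans hsM
    nlinarith [norm_nonneg l]
  have h2 := H h h0 h1 l hl0 hlM 2 ⟨by norm_num, by norm_num⟩ 1
  rw [shaped_gaussian_eq hl, primitiveSymbol_gaussian_three, hl, positionFactor_three_two] at h2
  refine primitiveWithin_re (𝕜 := ℂ) (differentiable_realGaussian s) ?_
  have e : ((u x + h ^ 3 * (s * deriv u x + iteratedDeriv 3 u x / 12) : ℝ) : ℂ) =
      (u x : ℂ) + ((1 / 12 * h ^ 3 : ℝ) : ℂ) *
        (((iteratedDeriv 3 u x : ℝ) : ℂ) + 12 * (s : ℂ) * ((deriv u x : ℝ) : ℂ)) := by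
    push_cast
    ring
  exact (congrArg (fun W => PrimitiveWithin 3 (fun y => ((realGaussian s y : ℝ) : ℂ)) u
    (x - 2 * h) h 1 x W (C * h ^ 4)) e).mpr h2

/-- The leading error is h³ u'(x) (s - s₀) with s₀ = -u'''(x)/(12 u'(x)), up to O(h⁴). Since u'(x) ≠
0, it is O(h⁴) exactly when s - s₀ = O(h). -/
theorem primitiveWithin_realGaussian_iff {u : ℝ → ℝ} {x : ℝ} (hu : ContDiffAt ℝ ∞ u x)
    (hux : deriv u x ≠ 0) {s : ℝ → ℝ} (hs0 : ∀ᶠ h in 𝓝[>] (0 : ℝ), s h ≠ 0)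
    (hs : s =O[𝓝[>] (0 : ℝ)] fun _ => (1 : ℝ)) :
    ((fun h => s h - -iteratedDeriv 3 u x / (12 * deriv u x)) =O[𝓝[>] (0 : ℝ)] (fun h => h) ↔
      ∃ C > (0 : ℝ), ∃ δ > (0 : ℝ), ∀ h : ℝ, 0 < h → h < δ →
        PrimitiveWithin 3 (realGaussian (s h)) u (x - 2 * h) h 1 x (u x) (C * h ^ 4)) := by
  obtain ⟨M, hM⟩ := hs.bound
  obtain ⟨C, hC, δ, hδ, H⟩ := primitiveWithin_realGaussian hu M
  obtain ⟨δ₁, hδ₁, H₁⟩ := mem_nhdsGT_iff_exists_Ioo_subset.mp (hs0.and hM)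
  have hδ₁' : 0 < δ₁ := hδ₁
  have hmain : ∀ h, 0 < h → h < min δ δ₁ → PrimitiveWithin 3 (realGaussian (s h)) u (x - 2 * h) h 1
      x (u x + h ^ 3 * (s h * deriv u x + iteratedDeriv 3 u x / 12)) (C * h ^ 4) :=
    fun h h0 h1 => H h h0 (h1.trans_le (min_le_left _ _)) _
      (H₁ ⟨h0, h1.trans_le (min_le_right _ _)⟩).1
      (by simpa using (H₁ ⟨h0, h1.trans_le (min_le_right _ _)⟩).2)
  have hsym : ∀ h, s h * deriv u x + iteratedDeriv 3 u x / 12 =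
      deriv u x * (s h - -iteratedDeriv 3 u x / (12 * deriv u x)) := fun h => by
    field_simp
    ring
  have hux' : 0 < |deriv u x| := abs_pos.mpr hux
  constructor
  · intro hO
    obtain ⟨c, hc, hcO⟩ := hO.exists_pos
    obtain ⟨δ₂, hδ₂, H₂⟩ := mem_nhdsGT_iff_exists_Ioo_subset.mp hcO.bound
    have hδ₂' : 0 < δ₂ := hδ₂
    refine ⟨C + |deriv u x| * c, by positivity, min (min δ δ₁) δ₂,
      lt_min (lt_min hδ hδ₁') hδ₂', fun h h0 h1 => ?_⟩
    rw [add_mul]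
    refine primitiveWithin_of_norm_sub_le (hmain h h0 (h1.trans_le (min_le_left _ _))) ?_
    have h2 : ‖s h - -iteratedDeriv 3 u x / (12 * deriv u x)‖ ≤ c * ‖h‖ :=
      H₂ ⟨h0, h1.trans_le (min_le_right _ _)⟩
    rw [Real.norm_of_nonneg h0.le] at h2
    rw [add_sub_cancel_left, hsym, norm_mul, norm_mul, Real.norm_of_nonneg (pow_nonneg h0.le 3),
      Real.norm_eq_abs (deriv u x)]
    calc h ^ 3 * (|deriv u x| * ‖s h - -iteratedDeriv 3 u x / (12 * deriv u x)‖)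
        ≤ h ^ 3 * (|deriv u x| * (c * h)) := by gcongr
      _ = _ := by ring
  · rintro ⟨C', hC', δ₂, hδ₂, H₂⟩
    refine IsBigO.of_bound ((C + C') / |deriv u x|) ?_
    filter_upwards [Ioo_mem_nhdsGT (lt_min (lt_min hδ hδ₁') hδ₂)] with h hh
    have h2 := norm_sub_le_of_primitiveWithin (hmain h hh.1 (hh.2.trans_le (min_le_left _ _)))
      (H₂ h hh.1 (hh.2.trans_le (min_le_right _ _)))
    have h3 : 0 < h ^ 3 := pow_pos hh.1 3
    rw [add_sub_cancel_left, hsym, norm_mul, norm_mul, Real.norm_of_nonneg h3.le,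
      Real.norm_eq_abs (deriv u x)] at h2
    rw [Real.norm_of_nonneg hh.1.le, div_mul_eq_mul_div, le_div_iff₀ hux']
    refine le_of_mul_le_mul_left ?_ h3
    calc _ = h ^ 3 * (|deriv u x| * ‖s h - -iteratedDeriv 3 u x / (12 * deriv u x)‖) := by ring
      _ ≤ C * h ^ 4 + C' * h ^ 4 := h2
      _ = _ := by ring

theorem theoremA1 (Ω : Set ℝ) (hΩ : IsOpen Ω) (u : ℝ → ℝ) (hu : ContDiffOn ℝ ∞ u Ω) :
    -- any smooth radial basis function, real or complex shape parameters, `N` odd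
    (∀ (𝕜 : Type) [RCLike 𝕜] (φ : 𝕜 → 𝕜), ContDiffAt 𝕜 ∞ φ 0 → (∀ z, φ (-z) = φ z) →
      ∀ N : ℕ, Odd N → ∀ x ∈ Ω,
        -- direct reconstruction: leading error term, and order `N + 1` where it vanishes
        ((derivMatrix φ N).det ≠ 0 →
          (∀ M : ℝ, ∃ C > (0 : ℝ), ∃ δ > (0 : ℝ), ∀ h : ℝ, 0 < h → h < δ →
            ∀ l : 𝕜, l ≠ 0 → ‖l‖ ≤ M → ∀ θ ∈ Set.Icc (0 : ℝ) N,
              DirectWithin N (shaped φ l) u (x - θ * h) h x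
                ((u x : 𝕜) + (positionFactor N θ * h ^ N : ℝ) * directSymbol N φ u x l)
                (C * h ^ (N + 1))) ∧
          (∀ l₀ : 𝕜, directSymbol N φ u x l₀ = 0 → ∀ l : ℝ → 𝕜,
            (∀ᶠ h in 𝓝[>] (0 : ℝ), l h ≠ 0) →
            (fun h => l h ^ 2 - l₀ ^ 2) =O[𝓝[>] (0 : ℝ)] (fun h => h) →
            DirectOrder N φ l u x (N + 1))) ∧
        -- reconstruction through a primitive function: the same
        ((derivMatrix φ (N + 1)).det ≠ 0 →
          (∀ M : ℝ, ∃ C > (0 : ℝ), ∃ δ > (0 : ℝ), ∀ h : ℝ, 0 < h → h < δ →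
            ∀ l : 𝕜, l ≠ 0 → ‖l‖ ≤ M → ∀ θ ∈ Set.Icc (0 : ℝ) N, ∀ b : Fin (N + 1),
              PrimitiveWithin N (shaped φ l) u (x - θ * h) h b x
                ((u x : 𝕜) + (positionFactor N θ * h ^ N : ℝ) * primitiveSymbol N φ u x l)
                (C * h ^ (N + 1))) ∧
          (∀ l₀ : 𝕜, primitiveSymbol N φ u x l₀ = 0 → ∀ l : ℝ → 𝕜,
            (∀ᶠ h in 𝓝[>] (0 : ℝ), l h ≠ 0) →
            (fun h => l h ^ 2 - l₀ ^ 2) =O[𝓝[>] (0 : ℝ)] (fun h => h) →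
            PrimitiveOrder N φ l u x (N + 1)))) ∧
    -- bounded shape parameters that give order `N + 1` exist, if `u'(x) ≠ 0`, for `N ≥ 3` odd
    (∀ φ : ℂ → ℂ, ContDiffAt ℂ ∞ φ 0 → (∀ z, φ (-z) = φ z) →
      ∀ N : ℕ, Odd N → ∀ hN : 3 ≤ N, ∀ x ∈ Ω, deriv u x ≠ 0 →
        ((derivMatrix φ N).det ≠ 0 → errorCoeff φ N ⟨1, by omega⟩ ≠ 0 →
          ∃ l : ℝ → ℂ, (∃ M : ℝ, ∀ h, ‖l h‖ ≤ M) ∧ DirectOrder N φ l u x (N + 1)) ∧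
        ((derivMatrix φ (N + 1)).det ≠ 0 → errorCoeff φ (N + 1) ⟨2, by omega⟩ ≠ 0 →
          ∃ l : ℝ → ℂ, (∃ M : ℝ, ∀ h, ‖l h‖ ≤ M) ∧ PrimitiveOrder N φ l u x (N + 1))) ∧
    -- the Gaussian satisfies the conditions for every `N`; real `λ²` suffice if `N ≡ 3 mod 4`
    (∀ n : ℕ, (derivMatrix gaussian n).det ≠ 0) ∧
    (∀ N : ℕ, Odd N → 3 ≤ N → ∀ x ∈ Ω, deriv u x ≠ 0 →
      (∃ l : ℝ → ℂ, (∃ M : ℝ, ∀ h, ‖l h‖ ≤ M) ∧ (N % 4 = 3 → ∀ h, (l h ^ 2).im = 0) ∧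
        DirectOrder N gaussian l u x (N + 1)) ∧
      (∃ l : ℝ → ℂ, (∃ M : ℝ, ∀ h, ‖l h‖ ≤ M) ∧ (N % 4 = 3 → ∀ h, (l h ^ 2).im = 0) ∧
        PrimitiveOrder N gaussian l u x (N + 1))) ∧
    -- `N = 3`, Gaussian, cells `j - 1, j, j + 1`, `x` the interface `j + 1/2`, `s = λ²`
    (∀ x ∈ Ω,
      (∀ M : ℝ, ∃ C > (0 : ℝ), ∃ δ > (0 : ℝ), ∀ h : ℝ, 0 < h → h < δ →
        ∀ s : ℝ, s ≠ 0 → |s| ≤ M →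
          PrimitiveWithin 3 (realGaussian s) u (x - 2 * h) h 1 x
            (u x + h ^ 3 * (s * deriv u x + iteratedDeriv 3 u x / 12)) (C * h ^ 4)) ∧
      (deriv u x ≠ 0 → ∀ s : ℝ → ℝ, (∀ᶠ h in 𝓝[>] (0 : ℝ), s h ≠ 0) →
        s =O[𝓝[>] (0 : ℝ)] (fun _ => (1 : ℝ)) →
        ((fun h => s h - -iteratedDeriv 3 u x / (12 * deriv u x)) =O[𝓝[>] (0 : ℝ)] (fun h => h) ↔
          ∃ C > (0 : ℝ), ∃ δ > (0 : ℝ), ∀ h : ℝ, 0 < h → h < δ →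
            PrimitiveWithin 3 (realGaussian (s h)) u (x - 2 * h) h 1 x (u x) (C * h ^ 4)))) := by
  have hux : ∀ x ∈ Ω, ContDiffAt ℝ ∞ u x := fun x hx => hu.contDiffAt (hΩ.mem_nhds hx)
  refine ⟨?_, ?_, det_derivMatrix_gaussian_ne_zero, ?_, ?_⟩
  · intro 𝕜 _ φ hφ heven N hN x hx
    exact ⟨fun hdet => ⟨directWithin_uniform hφ hdet (hux x hx), fun l₀ h₀ l hl0 hl =>
        directOrder_of_sq_sub_isBigO hφ heven hN hdet (hux x hx) h₀ hl0 hl⟩,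
      fun hdet => ⟨primitiveWithin_uniform hφ hdet (hux x hx), fun l₀ h₀ l hl0 hl =>
        primitiveOrder_of_sq_sub_isBigO hφ heven hN hdet (hux x hx) h₀ hl0 hl⟩⟩
  · intro φ hφ heven N hN hN3 x hx hd
    have hd' : ((iteratedDeriv 1 u x : ℝ) : ℂ) ≠ 0 := by
      rw [iteratedDeriv_one]; exact_mod_cast hd
    refine ⟨fun hdet hc => ?_, fun hdet hc => ?_⟩
    · obtain ⟨l₀, h₀⟩ := exists_sq_eval_symbolPoly_eq_zero hN3 (by omega) (c := errorCoeff φ N)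
        (a := fun j => ((iteratedDeriv j u x : ℝ) : ℂ))
        (fun j hj => errorCoeff_eq_zero_of_odd heven hdet j (hj.add_odd hN)) (mul_ne_zero hc hd')
      obtain ⟨l, hM, -, hl0, hl⟩ := exists_shape_parameters l₀
      exact ⟨l, hM, directOrder_of_sq_sub_isBigO hφ heven hN hdet (hux x hx)
        ((directSymbol_eq_eval heven hN hdet l₀).trans h₀) hl0 hl⟩
    · obtain ⟨l₀, h₀⟩ := exists_sq_eval_symbolPoly_eq_zero hN3 (by omega)
        (c := fun j => errorCoeff φ (N + 1) j.succ)
        (a := fun j => ((iteratedDeriv j u x : ℝ) : ℂ))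
        (errorCoeff_succ_eq_zero heven hN hdet) (mul_ne_zero hc hd')
      obtain ⟨l, hM, -, hl0, hl⟩ := exists_shape_parameters l₀
      exact ⟨l, hM, primitiveOrder_of_sq_sub_isBigO hφ heven hN hdet (hux x hx)
        ((primitiveSymbol_eq_eval heven hN hdet l₀).trans h₀) hl0 hl⟩
  · intro N hN hN3 x hx hd
    have hdet := det_derivMatrix_gaussian_ne_zero
    obtain ⟨i, hi⟩ := id hN
    constructor
    · obtain ⟨l₀, him, h₀⟩ := exists_root_of_gaussian_coeff hN3 (by omega) (e := fun j : Fin N => j)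
        (fun j hj => errorCoeff_eq_zero_of_odd gaussian_neg (hdet N) j (hj.add_odd hN))
        (by simpa only [show 1 + 2 * i = N by omega] using gaussPoly_coeff_pos 1 i) hd
      obtain ⟨l, hM, him', hl0, hl⟩ := exists_shape_parameters l₀
      exact ⟨l, hM, fun h4 => him' (him h4), directOrder_of_sq_sub_isBigO
        contDiff_gaussian.contDiffAt gaussian_neg hN (hdet N) (hux x hx)
        ((directSymbol_eq_eval gaussian_neg hN (hdet N) l₀).trans h₀) hl0 hl⟩
    · obtain ⟨l₀, him, h₀⟩ := exists_root_of_gaussian_coeff hN3 (by omega) (e := fun j : Fin N => j.succ)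
        (errorCoeff_succ_eq_zero gaussian_neg hN (hdet (N + 1)))
        (by
          have h2 := gaussPoly_coeff_pos 2 i
          rw [show 2 + 2 * i = N + 1 by omega] at h2
          exact h2) hd
      obtain ⟨l, hM, him', hl0, hl⟩ := exists_shape_parameters l₀
      exact ⟨l, hM, fun h4 => him' (him h4), primitiveOrder_of_sq_sub_isBigO
        contDiff_gaussian.contDiffAt gaussian_neg hN (hdet (N + 1)) (hux x hx)
        ((primitiveSymbol_eq_eval gaussian_neg hN (hdet (N + 1)) l₀).trans h₀) hl0 hl⟩
  · exact fun x hx => ⟨primitiveWithin_realGaussian (hux x hx), fun hd s hs0 hs =>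
      primitiveWithin_realGaussian_iff (hux x hx) hd hs0 hs⟩
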